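/- Let $(\Omega,\mathbf P)$ be a probability space of uncertainties $\delta$, let $n_x\ge 0$, $d=n_x^2$, $\alpha\in(0,1)$, $N\ge 1$, $m=\lceil N(1-\alpha)\rceil$, and suppose $N\ge m+d$. Let $\delta_1,\dots,\delta_N$ be i.i.d. samples with law $\mathbf P$. For an impact proxy $\bar q:\mathbb R^{n_x\times n_x}\times\Omega\to\mathbb R$ that is measurable in $\delta$, call $K$ an optimal controller for the samples $\delta_1,\dots,\delta_k$ if it is the $K$-component of an optimal solution of the empirical CVaR program $$\min_{K\in\mathbb R^{n_x\times n_x},\,y\in\mathbb R}\ y\quad\text{subject to}\quad \frac1m\sum_{j\in S}\bar q(K,\delta_j)\le y\ \text{ for all } S\subseteq\{1,\dots,k\},\ |S|=m .$$ Let $K_N^*$ be an optimal controller for $\delta_1,\dots,\delta_N$, let $\bar q_{(1)}(K)\ge\dots\ge\bar q_{(N)}(K)$ be the values $\bar q(K,\delta_1),\dots,\bar q(K,\delta_N)$ in nonincreasing order, and define the out-of-sample probability of shortfall $$PS(K_N^*)=\mathbf P\{\delta\in\Omega:\ \bar q(K_N^*,\delta)\ge\bar q_{(m+d)}(K_N^*)\}.$$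 Assume that for every $K$ the law of $\bar q(K,\delta)$ has no point masses, and that one of the following holds. (a) $\bar q(\cdot,\delta)$ is convex for every $\delta$, and for every $k\ge m+d$ and all $\delta_1,\dots,\delta_k\in\Omega$ there is exactly one optimal controller. (b) $\bar q$ is the regularized impact proxy of an uncertain control system, $\bar q(K,\delta)=\eta\|K\|_F^2+\sum_{i=2}^{n_xN_h}\sigma_i(\kappa^{-1})$ with $\eta>0$, a horizon $N_h$, and $\sigma_1\le\sigma_2\le\dots\le\sigma_{n_xN_h}$ the singular values. Here $A,\Delta A(\delta),B,C,C_J,L\in\mathbb R^{n_x\times n_x}$ with $B,C,C_J$ invertible, $A_\delta=A+\Delta A(\delta)$, $\kappa=F_pF_r^{-1}$, $F_p=(I_{N_h}\otimes C_J)F_{xa}$, $F_r=(I_{N_h}\otimes C)(F_{ea}+F_{ex}F_{xa})$, and $F_{xa},F_{ea},F_{ex}$ are the $N_h\times N_h$ block matrices whose $(i,j)$ blocks are respectively $(A_\delta+BKC)^{i-j}B$ and $(A_\delta-LC)^{i-j}B$ for $j\le i$, and $(A_\delta-LC)^{i-j-1}\Delta A(\delta)$ for $j<i$, and $0$ otherwise.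 (In this case there is, for all $\delta_1,\dots,\delta_N$, exactly one optimal controller $K_N^*$.) Then for every $\epsilon\in(0,1)$ $$\mathbf P^N\{PS(K_N^*)\le\epsilon\}=\int_0^{\epsilon}\frac{\Gamma(N+1)}{\Gamma(m+d)\,\Gamma(N+1-m-d)}\,p^{m+d-1}(1-p)^{N-m-d}\,dp .$$ -/

import Mathlib

open MeasureTheory
open scoped Kronecker

noncomputable section

namespace ShortfallControl

/-! ### Order statistics and the scenario program -/

/-- The `i`-th largest entry of `v` (counted from `1`): `v_(1) ≥ v_(2) ≥ … ≥ v_(N)`, that is, the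
`(N - i + 1)`-th entry when the entries are listed in nondecreasing order.
The value is `0` outside `1 ≤ i ≤ N`. -/
def orderStat {N : ℕ} (v : Fin N → ℝ) (i : ℕ) : ℝ :=
  if h : 1 ≤ i ∧ i ≤ N then v (Tuple.sort v ⟨N - i, by omega⟩) else 0

/-- The scenario program: the pair `(K, y)` satisfies `(1/m) ∑_{j ∈ S} q(K, δ_j) ≤ y` for
every choice `S` of `m` of the `N` sample indices. -/
def IsFeasible {Ω : Type*} {n N : ℕ} (m : ℕ) (q : Matrix (Fin n) (Fin n) ℝ → Ω → ℝ)
    (ω : Fin N → Ω) (K : Matrix (Fin n) (Fin n) ℝ) (y : ℝ) : Prop :=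
  ∀ S : Finset (Fin N), S.card = m → (1 / (m : ℝ)) * ∑ j ∈ S, q K (ω j) ≤ y

/-- `K` is an optimal controller of the scenario program with samples `ω`: it is the
`K`-component of a feasible pair `(K, y)` with the least possible `y`. -/
def IsOptimalController {Ω : Type*} {n N : ℕ} (m : ℕ) (q : Matrix (Fin n) (Fin n) ℝ → Ω → ℝ)
    (ω : Fin N → Ω) (K : Matrix (Fin n) (Fin n) ℝ) : Prop :=
  ∃ y : ℝ, IsFeasible m q ω K y ∧
    ∀ (K' : Matrix (Fin n) (Fin n) ℝ) (y' : ℝ), IsFeasible m q ω K' y' → y ≤ y'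

/-- The out-of-sample probability of shortfall of `K`, with the shortfall threshold `q_(k)(K)`:
the probability that a new uncertainty `δ` has `q(K, δ) ≥ q_(k)(K)`. -/
def probShortfall {Ω : Type*} [MeasurableSpace Ω] (P : Measure Ω) {n N : ℕ} (k : ℕ)
    (q : Matrix (Fin n) (Fin n) ℝ → Ω → ℝ) (ω : Fin N → Ω)
    (K : Matrix (Fin n) (Fin n) ℝ) : ℝ :=
  P.real {δ | orderStat (fun j => q K (ω j)) k ≤ q K δ}

/-- For every controller, the distribution of `q(K, δ)` has no point masses. -/
def NoPointMasses {Ω : Type*} [MeasurableSpace Ω] (P : Measure Ω) {n : ℕ}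
    (q : Matrix (Fin n) (Fin n) ℝ → Ω → ℝ) : Prop :=
  ∀ (K : Matrix (Fin n) (Fin n) ℝ) (c : ℝ), P {δ | q K δ = c} = 0

/-! ### The impact proxy of the uncertain closed loop -/

/-- The matrices of the uncertain control system: `A + ΔA δ` is the system matrix under the
uncertainty `δ`, `B` the input matrix, `C` the output matrix, `CJ` the matrix of the performance
output, and `L` the observer gain. -/
structure UncertainSystem (Ω : Type*) (n : ℕ) where
  A : Matrix (Fin n) (Fin n) ℝ
  ΔA : Ω → Matrix (Fin n) (Fin n) ℝ
  B : Matrix (Fin n) (Fin n) ℝ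
  C : Matrix (Fin n) (Fin n) ℝ
  CJ : Matrix (Fin n) (Fin n) ℝ
  L : Matrix (Fin n) (Fin n) ℝ

/-- The block lower triangular Toeplitz matrix with block `M ^ (i - j) * B` at `(i, j)`,
`j ≤ i`. -/
def stacked {n : ℕ} (h : ℕ) (M B : Matrix (Fin n) (Fin n) ℝ) :
    Matrix (Fin h × Fin n) (Fin h × Fin n) ℝ :=
  Matrix.of fun i j =>
    if j.1 ≤ i.1 then (M ^ (i.1.val - j.1.val) * B) i.2 j.2 else 0

/-- The block strictly lower triangular Toeplitz matrix with block `M ^ (i - j - 1) * D` at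
`(i, j)`, `j < i`. -/
def stackedStrict {n : ℕ} (h : ℕ) (M D : Matrix (Fin n) (Fin n) ℝ) :
    Matrix (Fin h × Fin n) (Fin h × Fin n) ℝ :=
  Matrix.of fun i j =>
    if j.1 < i.1 then (M ^ (i.1.val - j.1.val - 1) * D) i.2 j.2 else 0

namespace UncertainSystem

variable {Ω : Type*} {n : ℕ}

/-- The system matrix under the uncertainty `δ`. -/
def Aδ (s : UncertainSystem Ω n) (δ : Ω) : Matrix (Fin n) (Fin n) ℝ := s.A + s.ΔA δ

/-- Attack to stacked state. -/
def Fxa (s : UncertainSystem Ω n) (h : ℕ) (K : Matrix (Fin n) (Fin n) ℝ) (δ : Ω) :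
    Matrix (Fin h × Fin n) (Fin h × Fin n) ℝ :=
  stacked h (s.Aδ δ + s.B * K * s.C) s.B

/-- Attack to stacked estimation error. -/
def Fea (s : UncertainSystem Ω n) (h : ℕ) (δ : Ω) :
    Matrix (Fin h × Fin n) (Fin h × Fin n) ℝ :=
  stacked h (s.Aδ δ - s.L * s.C) s.B

/-- State to stacked estimation error. -/
def Fex (s : UncertainSystem Ω n) (h : ℕ) (δ : Ω) :
    Matrix (Fin h × Fin n) (Fin h × Fin n) ℝ :=
  stackedStrict h (s.Aδ δ - s.L * s.C) (s.ΔA δ)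

/-- Attack to stacked performance output. -/
def Fp (s : UncertainSystem Ω n) (h : ℕ) (K : Matrix (Fin n) (Fin n) ℝ) (δ : Ω) :
    Matrix (Fin h × Fin n) (Fin h × Fin n) ℝ :=
  ((1 : Matrix (Fin h) (Fin h) ℝ) ⊗ₖ s.CJ) * s.Fxa h K δ

/-- Attack to stacked detection output. -/
def Fr (s : UncertainSystem Ω n) (h : ℕ) (K : Matrix (Fin n) (Fin n) ℝ) (δ : Ω) :
    Matrix (Fin h × Fin n) (Fin h × Fin n) ℝ :=
  ((1 : Matrix (Fin h) (Fin h) ℝ) ⊗ₖ s.C) * (s.Fea h δ + s.Fex h δ * s.Fxa h K δ)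

/-- `κ = F_p F_r⁻¹`. -/
def kappa (s : UncertainSystem Ω n) (h : ℕ) (K : Matrix (Fin n) (Fin n) ℝ) (δ : Ω) :
    Matrix (Fin h × Fin n) (Fin h × Fin n) ℝ :=
  s.Fp h K δ * (s.Fr h K δ)⁻¹

/-- The impact proxy `η ‖K‖_F² + ∑ σ_i(κ⁻¹)`, where the sum is over all `n * h` singular values
of `κ⁻¹` except the smallest one. (Mathlib lists singular values from the largest down, starting
with the index `0`.) -/
def impactProxy (s : UncertainSystem Ω n) (h : ℕ) (η : ℝ) (K : Matrix (Fin n) (Fin n) ℝ)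
    (δ : Ω) : ℝ :=
  η * (∑ i, ∑ j, K i j ^ 2) +
    ∑ i ∈ Finset.range (n * h - 1),
      (Matrix.toEuclideanLin (s.kappa h K δ)⁻¹).singularValues i

end UncertainSystem

end ShortfallControl

end

/-! Put k = m + d. For k samples τ with optimal controller X(τ), let V(τ) be the probability that a
new uncertainty has a value at X(τ) no smaller than the least of the k sampled values
(`exceedProb`).

Deterministic half. An optimal controller minimises a sum of m largest among convex functions.
First-order optimality gives weights in [0, 1] of total m with balancing subgradients
(`exists_weights_subgradients`). The balance and the total are d + 1 linear equations, so an extreme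
point of the polytope of weights has at most d + 1 fractional entries, hence at most m + d nonzero
ones. The optimum for N samples is therefore also optimal for some k of them that are largest there
(`exists_top_subproblem`).

Probabilistic half. Without point masses, almost surely exactly one set of k samples lies strictly
above the others at its own optimum. That optimum is then the optimum for all N samples, and the
shortfall probability is V of the chosen samples. Given these, the other samples are independent and
each falls below with probability 1 - V. Summing over the sets, the probability of shortfall at most
ε is C(N, k) E[(1 - V)^(N - k); V ≤ ε] (`measure_probShortfall_le`). With ε = 1 and N = k + r the
left side is 1, so E(1 - V)^r = 1 / C(k + r, k) for every r. These are the moments of Beta(1, k),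
and moments determine a law on [0, 1] (`measure_ext_of_moments`). Inserting the law of V into the
formula gives the Beta integral.

For the control system, κ⁻¹ is affine in K (`kappa_inv`) and a sum of largest singular values is
convex (Ky Fan, `convexOn_sum_singularValues`). The regularization makes optima exist and be unique,
so the general result applies. -/

noncomputable section

namespace ShortfallControl

/-! ### The sum of the `m` largest entries -/

section TopSum

variable {ι κ : Type*}

/-- The sum of the `m` largest entries of `v`. -/
def topSum (m : ℕ) (v : ι → ℝ) : ℝ :=
  ⨆ S : {S : Finset ι // S.card = m}, ∑ j ∈ S.1, v j

lemma sum_le_topSum [Finite ι] {m : ℕ} (v : ι → ℝ) {S : Finset ι} (hS : S.card = m) :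
    ∑ j ∈ S, v j ≤ topSum m v :=
  le_ciSup (f := fun S : {S : Finset ι // S.card = m} => ∑ j ∈ S.1, v j)
    (Set.finite_range _).bddAbove ⟨S, hS⟩

lemma exists_topSum_eq [Fintype ι] {m : ℕ} (hm : m ≤ Fintype.card ι) (v : ι → ℝ) :
    ∃ S : Finset ι, S.card = m ∧ topSum m v = ∑ j ∈ S, v j := by
  obtain ⟨S, -, hS⟩ := Finset.exists_subset_card_eq (s := (Finset.univ : Finset ι)) hm
  have : Nonempty {S : Finset ι // S.card = m} := ⟨⟨S, hS⟩⟩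
  obtain ⟨T, hT⟩ := exists_eq_ciSup_of_finite
    (f := fun S : {S : Finset ι // S.card = m} => ∑ j ∈ S.1, v j)
  exact ⟨T.1, T.2, hT.symm⟩

/-- Weights in `[0, 1]` with total weight at most that of `S` give at most the sum over `S`, if a
threshold separates the values on `S` from the others. -/
lemma sum_mul_le_sum_of_threshold [Fintype ι] [DecidableEq ι] (a v : ι → ℝ) (S : Finset ι) (θ : ℝ)
    (h0 : ∀ j, 0 ≤ a j) (h1 : ∀ j, a j ≤ 1) (hθ : θ * (∑ j, a j - S.card) ≤ 0)
    (hS : ∀ j ∈ S, θ ≤ v j) (hS' : ∀ j ∉ S, v j ≤ θ) :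
    ∑ j, a j * v j ≤ ∑ j ∈ S, v j := by
  -- Termwise this says `(a j - 1_S j) * (v j - θ) ≤ 0`: the factors have opposite signs both on and
  -- off `S`.
  have key : ∀ j, a j * v j ≤ (if j ∈ S then v j else 0) + θ * (a j - if j ∈ S then 1 else 0) := by
    intro j
    by_cases hj : j ∈ S
    · simp only [hj, if_true]
      nlinarith [h1 j, hS j hj]
    · simp only [hj, if_false]
      nlinarith [h0 j, hS' j hj]
  calc ∑ j, a j * v j
      ≤ ∑ j, ((if j ∈ S then v j else 0) + θ * (a j - if j ∈ S then 1 else 0)) :=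
        Finset.sum_le_sum fun j _ => key j
    _ = ∑ j ∈ S, v j + θ * (∑ j, a j - S.card) := by
        rw [Finset.sum_add_distrib, ← Finset.mul_sum, Finset.sum_sub_distrib]
        simp
    _ ≤ _ := by linarith

/-- A set realising `topSum` has a threshold among its own values. -/
lemma exists_threshold [Fintype ι] {m : ℕ} (hm0 : 0 < m) (hm : m ≤ Fintype.card ι)
    (v : ι → ℝ) :
    ∃ S : Finset ι, S.card = m ∧ topSum m v = ∑ j ∈ S, v j ∧ ∃ i ∈ S,
      (∀ j ∈ S, v i ≤ v j) ∧ ∀ j ∉ S, v j ≤ v i := by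
  classical
  obtain ⟨S, hS, hST⟩ := exists_topSum_eq hm v
  obtain ⟨i, hi, hmin⟩ := S.exists_min_image v (Finset.card_pos.1 (by omega))
  refine ⟨S, hS, hST, i, hi, hmin, fun j hj => ?_⟩
  have hj' : j ∉ S.erase i := fun h => hj (Finset.mem_of_mem_erase h)
  -- Exchanging the minimal `i` for an outside `j` cannot increase the maximal sum.
  have := sum_le_topSum (m := m) v (S := insert j (S.erase i)) (by
    rw [Finset.card_insert_of_notMem hj', Finset.card_erase_of_mem hi]; omega)
  rw [Finset.sum_insert hj', hST, ← Finset.add_sum_erase S v hi] at this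
  linarith

lemma sum_mul_le_topSum [Fintype ι] {m : ℕ} (hm0 : 0 < m) (hm : m ≤ Fintype.card ι)
    (a v : ι → ℝ) (h0 : ∀ j, 0 ≤ a j) (h1 : ∀ j, a j ≤ 1) (hs : ∑ j, a j = m) :
    ∑ j, a j * v j ≤ topSum m v := by
  classical
  obtain ⟨S, hS, hST, i, -, hi, hi'⟩ := exists_threshold hm0 hm v
  rw [hST]
  exact sum_mul_le_sum_of_threshold a v S (v i) h0 h1 (by simp [hs, hS]) hi hi'

/-- Optimal weights sit on larger values first. -/
lemma le_of_weights_optimal [Fintype ι] {m : ℕ} (hm0 : 0 < m) (hm : m ≤ Fintype.card ι)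
    (a v : ι → ℝ) (h0 : ∀ j, 0 ≤ a j) (h1 : ∀ j, a j ≤ 1) (hs : ∑ j, a j = m)
    (hopt : ∑ j, a j * v j = topSum m v) {i j : ι} (hi : 0 < a i) (hj : a j < 1) :
    v j ≤ v i := by
  classical
  by_contra! hlt
  have hij : i ≠ j := by rintro rfl; exact lt_irrefl _ hlt
  -- Moving mass `t` from `i` to `j`, as much as the cube allows, would gain `t * (v j - v i) > 0`.
  set t := min (a i) (1 - a j) with ht
  have ht0 : 0 < t := lt_min hi (by linarith)
  set w : ι → ℝ := fun l => (if l = j then t else 0) - if l = i then t else 0 with hw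
  have hti : t ≤ a i := min_le_left _ _
  have htj : t ≤ 1 - a j := min_le_right _ _
  have := sum_mul_le_topSum hm0 hm (fun l => a l + w l) v
    (fun l => by
      simp only [hw]
      rcases eq_or_ne l i with rfl | h
      · simp [hij]; linarith
      · simp [h]; split_ifs <;> linarith [h0 l])
    (fun l => by
      simp only [hw]
      rcases eq_or_ne l j with rfl | h
      · simp [hij.symm]; linarith
      · simp [h]; split_ifs <;> linarith [h1 l])
    (by simp [hw, Finset.sum_add_distrib, hs])
  have e : ∑ l, (a l + w l) * v l = topSum m v + t * (v j - v i) := by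
    simp only [hw, add_mul, sub_mul, Finset.sum_add_distrib, Finset.sum_sub_distrib, hopt]
    simp; ring
  nlinarith

/-- A maximum of finitely many linear functionals. -/
lemma convexOn_topSum [Fintype ι] {m : ℕ} (hm : m ≤ Fintype.card ι) :
    ConvexOn ℝ Set.univ (topSum (ι := ι) m) := by
  refine ⟨convex_univ, fun v _ w _ a b ha hb _ => ?_⟩
  obtain ⟨S, hS, hST⟩ := exists_topSum_eq hm (a • v + b • w)
  rw [hST]
  simp only [Pi.add_apply, Pi.smul_apply, Finset.sum_add_distrib, smul_eq_mul, ← Finset.mul_sum]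
  gcongr <;> exact sum_le_topSum _ hS

lemma continuous_topSum [Fintype ι] {m : ℕ} (hm : m ≤ Fintype.card ι) :
    Continuous (topSum (ι := ι) m) :=
  continuousOn_univ.1 ((convexOn_topSum hm).continuousOn isOpen_univ)

lemma topSum_mono [Fintype ι] {m : ℕ} (hm : m ≤ Fintype.card ι) {v w : ι → ℝ} (h : v ≤ w) :
    topSum m v ≤ topSum m w := by
  obtain ⟨S, hS, hST⟩ := exists_topSum_eq hm v
  rw [hST]
  exact (Finset.sum_le_sum fun j _ => h j).trans (sum_le_topSum w hS)

/-- Changing a single entry by `t` raises the top sum by at most the positive part of `t`. -/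
lemma topSum_add_single_le [Fintype ι] [DecidableEq ι] {m : ℕ} (hm : m ≤ Fintype.card ι)
    (v : ι → ℝ) (i : ι) (t : ℝ) :
    topSum m (v + Pi.single i t) ≤ topSum m v + max 0 t := by
  obtain ⟨S, hS, hST⟩ := exists_topSum_eq hm (v + Pi.single i t)
  rw [hST]
  simp only [Pi.add_apply, Finset.sum_add_distrib, Finset.sum_pi_single']
  have := sum_le_topSum v hS
  split_ifs <;> linarith [le_max_left 0 t, le_max_right 0 t]

lemma topSum_add_const [Fintype ι] {m : ℕ} (hm : m ≤ Fintype.card ι) (v : ι → ℝ) (t : ℝ) :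
    topSum m (fun j => v j + t) = topSum m v + m * t := by
  apply le_antisymm
  · obtain ⟨S, hS, hST⟩ := exists_topSum_eq hm (fun j => v j + t)
    rw [hST, Finset.sum_add_distrib, Finset.sum_const, hS, nsmul_eq_mul]
    linarith [sum_le_topSum v hS]
  · obtain ⟨S, hS, hST⟩ := exists_topSum_eq hm v
    have := sum_le_topSum (fun j => v j + t) hS
    rw [Finset.sum_add_distrib, Finset.sum_const, hS, nsmul_eq_mul] at this
    linarith

lemma topSum_smul {m : ℕ} (v : ι → ℝ) {t : ℝ}
    (ht : 0 ≤ t) : topSum m (t • v) = t * topSum m v := by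
  simp only [topSum, Pi.smul_apply, smul_eq_mul, ← Finset.mul_sum]
  exact (Real.mul_iSup_of_nonneg ht _).symm

lemma topSum_comp_le [Fintype ι] [Fintype κ] {m : ℕ} (hm : m ≤ Fintype.card κ) (v : ι → ℝ)
    {e : κ → ι} (he : Function.Injective e) : topSum m (fun i => v (e i)) ≤ topSum m v := by
  obtain ⟨S, hS, hST⟩ := exists_topSum_eq hm (fun i => v (e i))
  rw [hST]
  have := sum_le_topSum v (S := S.map ⟨e, he⟩) (by rw [Finset.card_map, hS])
  simpa using this

/-- Only the entries in a set of large entries matter. -/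
lemma topSum_comp_eq [Fintype ι] [Fintype κ] {m : ℕ} (hm0 : 0 < m) (hm : m ≤ Fintype.card κ)
    (v : ι → ℝ) {e : κ → ι} (he : Function.Injective e)
    (htop : ∀ i, ∀ j ∉ Set.range e, v j ≤ v (e i)) :
    topSum m (fun i => v (e i)) = topSum m v := by
  classical
  refine le_antisymm (topSum_comp_le hm v he) ?_
  obtain ⟨S, hS, hST, i, hi, hi1, hi2⟩ := exists_threshold hm0 hm (fun i => v (e i))
  obtain ⟨T, hT, hTT⟩ := exists_topSum_eq (hm.trans (Fintype.card_le_of_injective e he)) v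
  have := sum_mul_le_sum_of_threshold (fun j => if j ∈ T then 1 else 0) v (S.map ⟨e, he⟩)
    (v (e i)) (fun j => by split_ifs <;> simp) (fun j => by split_ifs <;> simp)
    (by simp [hT, hS]) (by simpa using hi1) (fun j hj => by
      by_cases hr : j ∈ Set.range e
      · obtain ⟨l, rfl⟩ := hr
        exact hi2 l (by simpa [he.eq_iff] using hj)
      · exact htop i j hr)
  rw [hTT, hST]
  simpa using this

end TopSum

/-! ### Hahn-Banach and first-order optimality -/

/-- A convex function that is nonnegative on a subspace and vanishes at the origin is minorised by
a linear functional vanishing on the subspace. -/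
lemma exists_linear_le_convex {V : Type*} [NormedAddCommGroup V] [NormedSpace ℝ V]
    {Φ : V → ℝ} (hΦ : ConvexOn ℝ Set.univ Φ) (hc : Continuous Φ)
    (h0 : Φ 0 = 0) (W : Submodule ℝ V) (hW : ∀ w ∈ W, 0 ≤ Φ w) :
    ∃ G : V →L[ℝ] ℝ, (∀ v, G v ≤ Φ v) ∧ ∀ w ∈ W, G w = 0 := by
  -- Separate the strict epigraph of `Φ` from `W × {0}`.
  have hdisj : Disjoint {p : V × ℝ | p.1 ∈ Set.univ ∧ Φ p.1 < p.2}
      ((W.prod (⊥ : Submodule ℝ ℝ) : Submodule ℝ (V × ℝ)) : Set (V × ℝ)) := by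
    rw [Set.disjoint_left]
    rintro ⟨v, r⟩ ⟨-, hr⟩ ⟨hv, hr0⟩
    simp only [Submodule.mem_bot, SetLike.mem_coe] at hr0 hv hr
    linarith [hW v hv]
  obtain ⟨f, u, hf1, hf2⟩ := geometric_hahn_banach_open hΦ.convex_strict_epigraph
    (by simpa using isOpen_lt (hc.comp continuous_fst) continuous_snd)
    (W.prod (⊥ : Submodule ℝ ℝ)).convex hdisj
  have hu : u ≤ 0 := by simpa using hf2 0 (zero_mem _)
  -- A linear functional bounded below on a subspace vanishes there.
  have hfW : ∀ w ∈ W, f (w, 0) = 0 := by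
    intro w hw
    by_contra hne
    have := hf2 (((u - 1) / f (w, 0)) • (w, (0 : ℝ)))
      (Submodule.smul_mem _ _ ⟨hw, by simp⟩)
    rw [map_smul, smul_eq_mul, div_mul_cancel₀ _ hne] at this
    linarith
  set ρ := f (0, 1) with hρ
  have hsplit : ∀ v r, f (v, r) = f (v, 0) + r * ρ := by
    intro v r
    have : (v, r) = (v, (0 : ℝ)) + r • ((0 : V), (1 : ℝ)) := by simp
    rw [this, map_add, map_smul, smul_eq_mul]
  -- The separating hyperplane is not vertical, so it is the graph of a functional.
  have hρ0 : ρ < 0 := by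
    have := hf1 (0, 1) ⟨trivial, by simp [h0]⟩
    linarith
  have hle : ∀ v, f (v, 0) + Φ v * ρ ≤ 0 := by
    intro v
    by_contra! hpos
    set ε := (f (v, 0) + Φ v * ρ) / (-ρ) with hε
    have hε0 : 0 < ε := div_pos hpos (by linarith)
    have := hf1 (v, Φ v + ε) ⟨trivial, by simpa using hε0⟩
    rw [hsplit] at this
    have h2 : ε * ρ = -(f (v, 0) + Φ v * ρ) := by
      rw [hε, div_neg, neg_mul, div_mul_cancel₀ _ hρ0.ne]
    nlinarith
  refine ⟨(-ρ)⁻¹ • (f.comp (ContinuousLinearMap.inl ℝ V ℝ)), fun v => ?_, fun w hw => ?_⟩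
  · simp only [smul_apply, ContinuousLinearMap.comp_apply,
      ContinuousLinearMap.inl_apply, smul_eq_mul]
    rw [inv_mul_le_iff₀ (by linarith)]
    linarith [hle v]
  · simp [hfW w hw]

section Optimality

variable {ι : Type*} [Fintype ι]
  {E : Type*} [NormedAddCommGroup E] [NormedSpace ℝ E] [FiniteDimensional ℝ E]

/-- First-order optimality for the minimisation of a sum of largest values: optimal weights and
subgradients that balance. -/
lemma exists_weights_subgradients {m : ℕ} (hm : m ≤ Fintype.card ι)
    {q : ι → E → ℝ} (hq : ∀ j, ConvexOn ℝ Set.univ (q j)) {x : E}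
    (hx : ∀ y, topSum m (fun j => q j x) ≤ topSum m (fun j => q j y)) :
    ∃ (a : ι → ℝ) (g : ι → E →ₗ[ℝ] ℝ), (∀ j, 0 ≤ a j) ∧ (∀ j, a j ≤ 1) ∧ ∑ j, a j = m ∧
      ∑ j, a j * q j x = topSum m (fun j => q j x) ∧ ∑ j, a j • g j = 0 ∧
      ∀ j, 0 < a j → ∀ y, q j x + g j (y - x) ≤ q j y := by
  classical
  set c : ι → ℝ := fun j => q j x with hc
  -- Every index gets its own displacement in `E` and its own shift in ℝ. Optimality of `x` makes
  -- `Φ` nonnegative on common displacements with zero shifts. The linear minorant `G` splits by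
  -- index into weights (shift parts) and subgradients scaled by the weights (displacement parts).
  let Φ : (ι → E × ℝ) → ℝ := fun w =>
    topSum m (fun j => q j (x + (w j).1) + (w j).2) - topSum m c
  have hΦ : ConvexOn ℝ Set.univ Φ := by
    refine ⟨convex_univ, fun v _ w _ a b ha hb hab => ?_⟩
    have h1 : topSum m (fun j => q j (x + ((a • v + b • w) j).1) + ((a • v + b • w) j).2) ≤
        topSum m (a • (fun j => q j (x + (v j).1) + (v j).2) +
          b • (fun j => q j (x + (w j).1) + (w j).2)) := by
      refine topSum_mono hm fun j => ?_
      have h2 := (hq j).2 (Set.mem_univ (x + (v j).1)) (Set.mem_univ (x + (w j).1)) ha hb hab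
      have h3 : a • (x + (v j).1) + b • (x + (w j).1) = x + (a • (v j).1 + b • (w j).1) := by
        rw [smul_add, smul_add, add_add_add_comm, ← add_smul, hab, one_smul]
      rw [h3] at h2
      simp only [Pi.add_apply, Pi.smul_apply, Prod.fst_add, Prod.smul_fst, Prod.snd_add,
        Prod.smul_snd, smul_eq_mul] at h2 ⊢
      linarith
    have h4 := (convexOn_topSum hm).2 (Set.mem_univ (fun j => q j (x + (v j).1) + (v j).2))
      (Set.mem_univ (fun j => q j (x + (w j).1) + (w j).2)) ha hb hab
    simp only [Φ, smul_eq_mul] at h4 ⊢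
    have h5 : topSum m c = a * topSum m c + b * topSum m c := by rw [← add_mul, hab, one_mul]
    linarith
  obtain ⟨G, hG, hGW⟩ := exists_linear_le_convex hΦ
    (continuousOn_univ.1 (hΦ.continuousOn isOpen_univ)) (by simp [Φ, hc])
    (LinearMap.range (LinearMap.pi fun _ : ι => LinearMap.inl ℝ E ℝ)) (by
      rintro _ ⟨v, rfl⟩
      simpa [Φ] using hx (x + v))
  have hsingle : ∀ j v s, G (Pi.single j (v, s)) ≤ max 0 (q j (x + v) + s - c j) := by
    intro j v s
    refine (hG _).trans ?_
    have h1 := topSum_add_single_le hm c j (q j (x + v) + s - c j)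
    have h2 : (fun l => q l (x + (Pi.single (M := fun _ : ι => E × ℝ) j (v, s) l).1) +
        (Pi.single (M := fun _ : ι => E × ℝ) j (v, s) l).2) =
        c + Pi.single j (q j (x + v) + s - c j) := by
      ext l
      rcases eq_or_ne l j with rfl | hl
      · simp
      · simp [hl, hc]
    simp only [Φ, h2]
    linarith
  let Gj : ι → E →ₗ[ℝ] ℝ := fun j => G.toLinearMap ∘ₗ LinearMap.single ℝ (fun _ => E × ℝ) j ∘ₗ
    LinearMap.inl ℝ E ℝ
  have hGj : ∀ j v, Gj j v = G (Pi.single j (v, 0)) := fun j v => rfl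
  set a : ι → ℝ := fun j => G (Pi.single j (0, 1)) with ha
  have haG : ∀ j s, G (Pi.single j (0, s)) = a j * s := by
    intro j s
    have : (Pi.single j ((0 : E), s) : ι → E × ℝ) = s • Pi.single j ((0 : E), (1 : ℝ)) := by
      rw [← Pi.single_smul]; simp
    rw [this, map_smul, smul_eq_mul, mul_comm]
  have hadd : ∀ j v s, G (Pi.single j (v, s)) = Gj j v + a j * s := by
    intro j v s
    rw [← haG, hGj, ← map_add, ← Pi.single_add]
    simp
  have hsum : ∀ s : ι → ℝ, ∑ j, a j * s j ≤ topSum m (c + s) - topSum m c := by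
    intro s
    have h1 := hG (∑ j, Pi.single j ((0 : E), s j))
    rw [map_sum] at h1
    simp only [haG] at h1
    rw [Finset.univ_sum_single (fun j => ((0 : E), s j))] at h1
    simp only [Φ, add_zero] at h1
    exact h1
  -- The shift `c j - q j (x + v)` cancels the change of the `j`-th value, so the bound in `hsingle`
  -- becomes 0.
  have hGle : ∀ j v, Gj j v ≤ a j * (q j (x + v) - c j) := by
    intro j v
    have := hsingle j v (c j - q j (x + v))
    rw [hadd] at this
    simp at this
    linarith
  have ha0 : ∀ j, 0 ≤ a j := by
    intro j
    have := hsingle j 0 (-1)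
    rw [haG] at this
    simp [hc] at this
    linarith
  have ha1 : ∀ j, a j ≤ 1 := by
    intro j
    have := hsingle j 0 1
    rw [haG] at this
    simpa [hc] using this
  have hGsum : ∑ j, Gj j = 0 := by
    ext v
    have h1 := hGW (fun _ => (v, 0)) ⟨v, by ext <;> simp⟩
    rw [← Finset.univ_sum_single (fun _ : ι => (v, (0 : ℝ))), map_sum] at h1
    simpa [hGj] using h1
  refine ⟨a, fun j => (a j)⁻¹ • Gj j, ha0, ha1, ?_, ?_, ?_, fun j hj y => ?_⟩
  -- Common shifts by 1 and -1 change the top sum by exactly `m` and `-m`.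
  · have h1 := hsum (fun _ => 1)
    have h2 := hsum (fun _ => -1)
    have h3 := topSum_add_const hm c 1
    have h4 := topSum_add_const hm c (-1)
    simp only [← Finset.sum_mul] at h1 h2
    change _ ≤ topSum m (fun j => c j + 1) - _ at h1
    change _ ≤ topSum m (fun j => c j + -1) - _ at h2
    linarith
  -- Homogeneity: the perturbation `c` doubles the top sum and `-c` reduces it to 0.
  · have h1 := hsum c
    have h2 := hsum (-c)
    have h3 := topSum_smul (m := m) c (t := 2) (by norm_num)
    have h4 := topSum_smul (m := m) c (t := 0) le_rfl
    rw [two_smul] at h3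
    rw [zero_smul] at h4
    rw [add_neg_cancel, h4] at h2
    simp only [Pi.neg_apply, mul_neg, Finset.sum_neg_distrib] at h2
    linarith
  · rw [← hGsum]
    refine Finset.sum_congr rfl fun j _ => ?_
    rcases (ha0 j).eq_or_lt with h | h
    · have hz : Gj j = 0 := by
        ext v
        have h1 := hGle j v
        have h2 := hGle j (-v)
        rw [map_neg] at h2
        rw [← h, zero_mul] at h1 h2
        simpa using le_antisymm h1 (by linarith)
      simp [hz]
    · rw [smul_smul, mul_inv_cancel₀ h.ne', one_smul]
  · have h1 := hGle j (y - x)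
    rw [add_sub_cancel] at h1
    have h2 : ((a j)⁻¹ • Gj j) (y - x) ≤ q j y - c j := by
      rw [LinearMap.smul_apply, smul_eq_mul, inv_mul_le_iff₀ hj]
      exact h1
    linarith

/-- The polytope of weights in the cube subject to finitely many linear equations has a point with
at most as many fractional coordinates as there are equations. -/
lemma exists_few_fractional {F : Type*} [AddCommGroup F] [Module ℝ F] [FiniteDimensional ℝ F]
    (ℓ : (ι → ℝ) →ₗ[ℝ] F) (a : ι → ℝ) (h0 : ∀ j, 0 ≤ a j) (h1 : ∀ j, a j ≤ 1) :
    ∃ b : ι → ℝ, (∀ j, 0 ≤ b j) ∧ (∀ j, b j ≤ 1) ∧ ℓ b = ℓ a ∧ (∀ j, a j = 0 → b j = 0) ∧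
      (∀ j, a j = 1 → b j = 1) ∧
      (Finset.univ.filter fun j => 0 < b j ∧ b j < 1).card ≤ Module.finrank ℝ F := by
  classical
  -- The last condition confines the polytope to the face of the cube containing `a`, so entries
  -- equal to 0 or 1 stay fixed.
  let M : Set (ι → ℝ) := Set.Icc 0 1 ∩ {b | b - a ∈ LinearMap.ker ℓ} ∩
    {b | ∀ j, (a j = 0 → b j = 0) ∧ (a j = 1 → b j = 1)}
  have hMc : IsCompact M := by
    refine (isCompact_Icc.inter_right ?_).inter_right ?_
    · exact (LinearMap.ker ℓ).closed_of_finiteDimensional.preimage (by fun_prop)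
    · simp only [Set.ofPred_forall, Set.ofPred_and]
      refine isClosed_iInter fun j => ?_
      refine IsClosed.inter (isClosed_iInter fun _ => ?_) (isClosed_iInter fun _ => ?_)
      · exact isClosed_eq (by fun_prop) continuous_const
      · exact isClosed_eq (by fun_prop) continuous_const
  obtain ⟨b, hb⟩ := hMc.extremePoints_nonempty
    ⟨a, ⟨⟨fun j => h0 j, fun j => h1 j⟩, by simp⟩, fun j => ⟨id, id⟩⟩
  obtain ⟨⟨⟨⟨hb0, hb1⟩, hbℓ⟩, hba⟩, hext⟩ := hb
  refine ⟨b, hb0, hb1, ?_, fun j => (hba j).1, fun j => (hba j).2, ?_⟩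
  · simpa [sub_eq_zero] using hbℓ
  by_contra! hcard
  set s := Finset.univ.filter fun j => 0 < b j ∧ b j < 1 with hs
  -- More fractional coordinates than equations leave a nonzero kernel direction supported on them.
  -- Small moves along it in both directions stay in `M`, against extremality.
  have hker := LinearMap.ker_ne_bot_of_finrank_lt
    (f := ℓ ∘ₗ Function.ExtendByZero.linearMap ℝ (Subtype.val : s → ι)) (by simpa using hcard)
  obtain ⟨w', hw', hw'0⟩ := Submodule.exists_mem_ne_zero_of_ne_bot hker
  set w : ι → ℝ := Function.ExtendByZero.linearMap ℝ (Subtype.val : s → ι) w' with hw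
  have hℓw : ℓ w = 0 := hw'
  have hws : ∀ j ∉ s, w j = 0 := by
    intro j hj
    rw [hw, Function.ExtendByZero.linearMap_apply, Function.extend_apply' _ _ _ (by simpa using hj)]
    rfl
  have hw0 : w ≠ 0 := by
    obtain ⟨j, hj⟩ := Function.ne_iff.1 hw'0
    refine Function.ne_iff.2 ⟨j, ?_⟩
    rwa [hw, Function.ExtendByZero.linearMap_apply, Subtype.val_injective.extend_apply]
  have hnear : ∀ᶠ t in nhds (0 : ℝ), ∀ j, 0 ≤ b j + t * w j ∧ b j + t * w j ≤ 1 := by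
    refine Filter.eventually_all.2 fun j => ?_
    by_cases hj : j ∈ s
    · have hbj : b j + 0 * w j ∈ Set.Ioo (0 : ℝ) 1 := by simpa [hs] using hj
      have hct : Continuous fun t : ℝ => b j + t * w j := by fun_prop
      filter_upwards [hct.continuousAt.eventually (isOpen_Ioo.mem_nhds hbj)] with t ht
      exact ⟨ht.1.le, ht.2.le⟩
    · simp only [hws j hj, mul_zero, add_zero]
      exact Filter.Eventually.of_forall fun _ => ⟨hb0 j, hb1 j⟩
  have hmem : ∀ t : ℝ, (∀ j, 0 ≤ b j + t * w j ∧ b j + t * w j ≤ 1) → b + t • w ∈ M := by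
    intro t ht
    refine ⟨⟨⟨fun j => (ht j).1, fun j => (ht j).2⟩, ?_⟩, fun j => ?_⟩
    · have : b + t • w - a = (b - a) + t • w := by abel
      rw [Set.mem_ofPred_eq, this]
      exact Submodule.add_mem _ hbℓ (Submodule.smul_mem _ _ hℓw)
    · have hz : b j = 0 ∨ b j = 1 → w j = 0 := by
        intro h
        refine hws j fun hj => ?_
        simp only [hs, Finset.mem_filter, Finset.mem_univ, true_and] at hj
        rcases h with h | h <;> linarith
      simp only [Pi.add_apply, Pi.smul_apply, smul_eq_mul]
      constructor
      · intro h
        simp [hz (.inl ((hba j).1 h)), (hba j).1 h]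
      · intro h
        simp [hz (.inr ((hba j).2 h)), (hba j).2 h]
  have hneg : ∀ᶠ t in nhds (0 : ℝ), ∀ j, 0 ≤ b j + -t * w j ∧ b j + -t * w j ≤ 1 := by
    have : Filter.Tendsto (fun t : ℝ => -t) (nhds 0) (nhds 0) := by
      simpa using (continuous_neg (G := ℝ)).tendsto 0
    exact this.eventually hnear
  obtain ⟨t, ⟨ht1, ht2⟩, ht0⟩ := (((hnear.and hneg).filter_mono
    (nhdsWithin_le_nhds (s := Set.Ioi 0))).and self_mem_nhdsWithin).exists
  have := hext (hmem t ht1) (hmem (-t) ht2) ⟨1 / 2, 1 / 2, by norm_num, by norm_num, by norm_num, by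
    ext j; simp; ring⟩
  have h3 : t • w = 0 := by simpa using this
  rcases smul_eq_zero.1 h3 with h | h
  · exact (ne_of_gt ht0) h
  · exact hw0 h

/-- A set of largest values can be enlarged to one of prescribed size. -/
lemma exists_top_superset (c : ι → ℝ) {s : Finset ι} (hs : ∀ i ∈ s, ∀ j ∉ s, c j ≤ c i) {n : ℕ}
    (hsn : s.card ≤ n) (hn : n ≤ Fintype.card ι) :
    ∃ I : Finset ι, s ⊆ I ∧ I.card = n ∧ ∀ i ∈ I, ∀ j ∉ I, c j ≤ c i := by
  classical
  induction n, hsn using Nat.le_induction with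
  | base => exact ⟨s, subset_rfl, rfl, hs⟩
  | succ n _ ih =>
    obtain ⟨I, hsI, hIn, hI⟩ := ih (by omega)
    have hne : Iᶜ.Nonempty := by
      rw [← Finset.card_pos, Finset.card_compl]
      omega
    obtain ⟨l, hl, hmax⟩ := Iᶜ.exists_max_image c hne
    rw [Finset.mem_compl] at hl
    refine ⟨insert l I, hsI.trans (Finset.subset_insert _ _), by
      rw [Finset.card_insert_of_notMem hl, hIn], fun i hi j hj => ?_⟩
    rw [Finset.mem_insert, not_or] at hj
    rcases Finset.mem_insert.1 hi with rfl | hi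
    · exact hmax j (by simpa using hj.2)
    · exact hI i hi j hj.2

/-- A minimiser of the sum of the `m` largest of finitely many convex functions is already
determined by some `m + dim E` of the functions that are largest there. -/
lemma exists_top_support {m : ℕ} (hm0 : 0 < m)
    (hm : m + Module.finrank ℝ E ≤ Fintype.card ι)
    {q : ι → E → ℝ} (hq : ∀ j, ConvexOn ℝ Set.univ (q j)) {x : E}
    (hx : ∀ y, topSum m (fun j => q j x) ≤ topSum m (fun j => q j y)) :
    ∃ I : Finset ι, I.card = m + Module.finrank ℝ E ∧ (∀ i ∈ I, ∀ j ∉ I, q j x ≤ q i x) ∧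
      ∃ b : ι → ℝ, (∀ j, 0 ≤ b j) ∧ (∀ j, b j ≤ 1) ∧ ∑ j, b j = m ∧ (∀ j ∉ I, b j = 0) ∧
        ∀ y, topSum m (fun j => q j x) ≤ ∑ j, b j * q j y := by
  have hmι : m ≤ Fintype.card ι := by omega
  obtain ⟨a, g, ha0, ha1, ham, hac, hag, hsub⟩ := exists_weights_subgradients hmι hq hx
  let ℓ : (ι → ℝ) →ₗ[ℝ] ℝ × (E →ₗ[ℝ] ℝ) :=
    (∑ j, LinearMap.proj j).prod (∑ j, (LinearMap.proj j).smulRight (g j))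
  have hℓ : ∀ b, ℓ b = (∑ j, b j, ∑ j, b j • g j) := by
    intro b; simp [ℓ]
  obtain ⟨b, hb0, hb1, hbℓ, hba0, hba1, hcard⟩ := exists_few_fractional ℓ a ha0 ha1
  rw [hℓ, hℓ, Prod.mk.injEq, ham, hag] at hbℓ
  obtain ⟨hbm, hbg⟩ := hbℓ
  -- Optimality of the weights needs no equation of its own: `a` and `b` differ only where `a` is
  -- fractional, and there all values at `x` agree by exchange, while the totals coincide.
  have hbc : ∑ j, b j * q j x = topSum m (fun j => q j x) := by
    rw [← hac]
    by_cases hfr : ∃ i, 0 < a i ∧ a i < 1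
    · obtain ⟨i, hi0, hi1⟩ := hfr
      have h1 : ∀ j, (b j - a j) * q j x = (b j - a j) * q i x := by
        intro j
        rcases (ha0 j).eq_or_lt with h | h
        · rw [hba0 j h.symm, ← h]; simp
        rcases (ha1 j).eq_or_lt with h' | h'
        · rw [hba1 j h', h']; simp
        rw [le_antisymm (le_of_weights_optimal hm0 hmι a _ ha0 ha1 ham hac hi0 h')
          (le_of_weights_optimal hm0 hmι a _ ha0 ha1 ham hac h hi1)]
      have h2 : ∑ j, (b j - a j) * q j x = 0 := by
        rw [Finset.sum_congr rfl fun j _ => h1 j, ← Finset.sum_mul, Finset.sum_sub_distrib, hbm, ham]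
        simp
      simp only [sub_mul, Finset.sum_sub_distrib] at h2
      linarith
    · push Not at hfr
      refine Finset.sum_congr rfl fun j _ => ?_
      rcases (ha0 j).eq_or_lt with h | h
      · rw [hba0 j h.symm, ← h]
      · have h' := le_antisymm (ha1 j) (hfr j h)
        rw [hba1 j h', h']
  set s := Finset.univ.filter fun j => 0 < b j with hs
  have hbs : ∀ j ∉ s, b j = 0 := fun j hj => by
    simp only [hs, Finset.mem_filter, Finset.mem_univ, true_and, not_lt] at hj
    exact le_antisymm hj (hb0 j)
  -- There are at most d + 1 fractional entries, each with defect `1 - b j < 1`, and the defects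
  -- over `s` add up to `s.card - m`. The strictness improves the bound d + 1 to d.
  have hscard : s.card ≤ m + Module.finrank ℝ E := by
    rw [Module.finrank_prod, Module.finrank_self, Module.finrank_linearMap_self] at hcard
    by_contra! hlt
    have h1 : ∑ j ∈ s, (1 - b j) = s.card - m := by
      rw [Finset.sum_sub_distrib, Finset.sum_const, nsmul_eq_mul, mul_one, ← hbm]
      congr 1
      exact Finset.sum_subset (Finset.subset_univ _) fun j _ hj => hbs j hj
    set t := Finset.univ.filter fun j => 0 < b j ∧ b j < 1 with ht
    have h2 : ∑ j ∈ s, (1 - b j) = ∑ j ∈ t, (1 - b j) := by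
      symm
      refine Finset.sum_subset (fun j => ?_) fun j hj hj' => ?_
      · simp only [ht, hs, Finset.mem_filter]; tauto
      · simp only [ht, hs, Finset.mem_filter, Finset.mem_univ, true_and, not_and, not_lt] at hj hj'
        linarith [hb1 j, hj' hj]
    have h3 : (m : ℝ) + Module.finrank ℝ E + 1 ≤ s.card := by exact_mod_cast hlt
    have h4 : (t.card : ℝ) ≤ 1 + Module.finrank ℝ E := by exact_mod_cast hcard
    rcases t.eq_empty_or_nonempty with h5 | h5
    · rw [h5, Finset.sum_empty] at h2
      have : (0 : ℝ) ≤ Module.finrank ℝ E := Nat.cast_nonneg _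
      linarith
    · have h6 : ∑ j ∈ t, (1 - b j) < ∑ j ∈ t, (1 : ℝ) :=
        Finset.sum_lt_sum_of_nonempty h5 fun j hj => by
          simp only [ht, Finset.mem_filter] at hj
          linarith [hj.2.1]
      rw [Finset.sum_const, nsmul_eq_mul, mul_one] at h6
      linarith
  obtain ⟨I, hsI, hIcard, hI⟩ := exists_top_superset (fun j => q j x) (s := s) (fun i hi j hj =>
    le_of_weights_optimal hm0 hmι b _ hb0 hb1 hbm hbc (by simpa [hs] using hi)
      (by rw [hbs j hj]; norm_num)) hscard hm
  refine ⟨I, hIcard, hI, b, hb0, hb1, hbm, fun j hj => hbs j fun h => hj (hsI h), fun y => ?_⟩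
  have h1 : ∑ j, b j * (q j x + g j (y - x)) = topSum m (fun j => q j x) := by
    have h2 : (∑ j, b j • g j) (y - x) = 0 := by rw [hbg]; rfl
    simp only [LinearMap.sum_apply, LinearMap.smul_apply, smul_eq_mul] at h2
    simp only [mul_add, Finset.sum_add_distrib, hbc, h2, add_zero]
  rw [← h1]
  refine Finset.sum_le_sum fun j _ => ?_
  rcases (hb0 j).eq_or_lt with h | h
  · rw [← h]; simp
  · have ha : 0 < a j := (ha0 j).lt_of_ne fun h' => h.ne' (hba0 j h'.symm)
    exact mul_le_mul_of_nonneg_left (hsub j ha y) (hb0 j)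

/-- A minimiser of the sum of the `m` largest of finitely many convex functions also minimises the
sum of the `m` largest among some `m + dim E` of the functions, which are largest there. -/
lemma exists_top_subproblem {m : ℕ} (hm0 : 0 < m)
    (hm : m + Module.finrank ℝ E ≤ Fintype.card ι)
    {q : ι → E → ℝ} (hq : ∀ j, ConvexOn ℝ Set.univ (q j)) {x : E}
    (hx : ∀ y, topSum m (fun j => q j x) ≤ topSum m (fun j => q j y)) :
    ∃ I : Finset ι, I.card = m + Module.finrank ℝ E ∧ (∀ i ∈ I, ∀ j ∉ I, q j x ≤ q i x) ∧
      ∀ {κ : Type} [Fintype κ] (e : κ → ι), Function.Injective e → Set.range e = I →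
        ∀ y, topSum m (fun i => q (e i) x) ≤ topSum m (fun i => q (e i) y) := by
  classical
  obtain ⟨I, hIcard, hI, b, hb0, hb1, hbm, hbI, hb⟩ := exists_top_support hm0 hm hq hx
  refine ⟨I, hIcard, hI, fun {κ} _ e he heI y => ?_⟩
  have hκ : Fintype.card κ = I.card := by
    rw [← Set.ncard_coe_finset I, ← heI, Set.ncard_range_of_injective he, Nat.card_eq_fintype_card]
  have hsum : ∀ f : ι → ℝ, (∀ j ∉ I, f j = 0) → ∑ i, f (e i) = ∑ j, f j := by
    intro f hf
    exact Fintype.sum_of_injective e he _ _ (fun j hj => hf j (by rw [heI] at hj; exact hj))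
      fun _ => rfl
  have hmκ : m ≤ Fintype.card κ := by omega
  -- The weights live on `I`, so they certify optimality in the subproblem as well.
  calc topSum m (fun i => q (e i) x) ≤ topSum m (fun j => q j x) :=
        topSum_comp_le hmκ (fun j => q j x) he
    _ ≤ ∑ j, b j * q j y := hb y
    _ = ∑ i, b (e i) * q (e i) y := (hsum _ fun j hj => by rw [hbI j hj, zero_mul]).symm
    _ ≤ _ := sum_mul_le_topSum hm0 hmκ _ _ (fun _ => hb0 _) (fun _ => hb1 _)
        (by rw [hsum b hbI, hbm])

end Optimality

/-! ### Measurability of a unique minimiser -/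

/-- The unique minimiser of a function that is continuous in the decision and measurable in the
parameter depends measurably on the parameter. -/
lemma measurable_argmin {E Ω : Type*} [MetricSpace E] [ProperSpace E] [MeasurableSpace E]
    [BorelSpace E] [MeasurableSpace Ω] {f : E → Ω → ℝ} (hc : ∀ ω, Continuous fun x => f x ω)
    (hm : ∀ x, Measurable (f x)) {X : Ω → E} (hX : ∀ ω y, f (X ω) ω ≤ f y ω)
    (huniq : ∀ ω x, (∀ y, f x ω ≤ f y ω) → x = X ω) : Measurable X := by
  have hcpt : ∀ K : Set E, IsCompact K → MeasurableSet (X ⁻¹' K) := by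
    intro K hK
    obtain ⟨D, hDc, hD⟩ := TopologicalSpace.exists_countable_dense E
    obtain ⟨D', hDc', hD'⟩ := TopologicalSpace.exists_countable_dense K
    -- The minimiser lies in the compact `K` exactly when the infimum over `K` does not exceed the
    -- values on all of `E`. By continuity countable dense sets suffice, and uniqueness identifies
    -- the minimiser over `K` with `X ω`.
    have hset : X ⁻¹' K = ⋂ y ∈ D, ⋂ n : ℕ, ⋃ b ∈ D', {ω | f b ω < f y ω + 1 / (n + 1 : ℝ)} := by
      ext ω
      simp only [Set.mem_preimage, Set.mem_iInter, Set.mem_iUnion, Set.mem_ofPred_eq, exists_prop]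
      constructor
      · intro hω y _ n
        have hopen : IsOpen {b : K | f b ω < f y ω + 1 / (n + 1 : ℝ)} :=
          isOpen_lt ((hc ω).comp continuous_subtype_val) continuous_const
        obtain ⟨b, hb, hbD⟩ := hD'.inter_open_nonempty _ hopen ⟨⟨X ω, hω⟩, by
          have : (0 : ℝ) < 1 / (n + 1 : ℝ) := by positivity
          simp only [Set.mem_ofPred_eq]
          linarith [hX ω y]⟩
        exact ⟨b, hbD, hb⟩
      · intro h
        obtain ⟨y₀, hy₀⟩ : D.Nonempty := by
          have : Nonempty E := ⟨X ω⟩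
          exact hD.nonempty
        obtain ⟨b₀, -, -⟩ := h y₀ hy₀ 0
        obtain ⟨x, hxK, hxmin⟩ := hK.exists_isMinOn ⟨b₀.1, b₀.2⟩ (hc ω).continuousOn
        have hxD : ∀ y ∈ D, f x ω ≤ f y ω := by
          intro y hy
          refine le_of_forall_pos_lt_add fun ε hε => ?_
          obtain ⟨n, hn⟩ := exists_nat_one_div_lt hε
          obtain ⟨b, -, hb⟩ := h y hy n
          have := isMinOn_iff.1 hxmin b b.2
          linarith
        have hall : ∀ y, f x ω ≤ f y ω := fun y =>
          hD.induction (P := fun y => f x ω ≤ f y ω) hxD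
            (isClosed_le continuous_const (hc ω)) y
        rw [← huniq ω x hall]
        exact hxK
    rw [hset]
    refine MeasurableSet.biInter hDc fun y _ => MeasurableSet.iInter fun n =>
      MeasurableSet.biUnion hDc' fun b _ => ?_
    exact measurableSet_lt (hm _) ((hm _).add_const _)
  refine measurable_of_isClosed fun C hC => ?_
  rcases isEmpty_or_nonempty E with hE | ⟨⟨x₀⟩⟩
  · have : C = ∅ := Set.eq_empty_of_isEmpty C
    simp [this]
  · have : X ⁻¹' C = ⋃ n : ℕ, X ⁻¹' (C ∩ Metric.closedBall x₀ n) := by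
      rw [← Set.preimage_iUnion, ← Set.inter_iUnion, Metric.iUnion_closedBall_nat, Set.inter_univ]
    rw [this]
    exact MeasurableSet.iUnion fun n => hcpt _ ((isCompact_closedBall _ _).inter_left hC)

/-! ### Order statistics -/

/-- If the sets differed, each would have a point outside the other, and the two comparisons of
these points would conflict. -/
lemma top_unique {ι : Type*} (v : ι → ℝ) {I J : Finset ι} (hIJ : I.card = J.card)
    (hI : ∀ i ∈ I, ∀ j ∉ I, v j < v i) (hJ : ∀ i ∈ J, ∀ j ∉ J, v j ≤ v i) : I = J := by
  by_contra hne
  obtain ⟨r, hrI, hrJ⟩ := Finset.not_subset.1 fun h => hne (Finset.eq_of_subset_of_card_le h hIJ.ge)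
  obtain ⟨s, hsJ, hsI⟩ := Finset.not_subset.1 fun h =>
    hne (Finset.eq_of_subset_of_card_le h hIJ.le).symm
  exact absurd (hJ s hsJ r hrJ) (not_le.2 (hI r hrI s hsI))

/-- The `k`-th largest entry is the least value on the set of `k` strictly largest entries. -/
lemma orderStat_le_iff {N k : ℕ} (hk : 1 ≤ k) (v : Fin N → ℝ) {I : Finset (Fin N)}
    (hIk : I.card = k) (hI : ∀ i ∈ I, ∀ j ∉ I, v j < v i) (x : ℝ) :
    orderStat v k ≤ x ↔ ∃ i ∈ I, v i ≤ x := by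
  have hkN : k ≤ N := by simpa [hIk] using I.card_le_univ
  have hpos : N - k < N := by omega
  have hmono := Tuple.monotone_sort v
  rw [orderStat, dif_pos ⟨hk, hkN⟩]
  have hIJ : I = (Finset.Ici (⟨N - k, hpos⟩ : Fin N)).map (Tuple.sort v).toEmbedding := by
    refine top_unique v ?_ hI ?_
    · rw [Finset.card_map, Fin.card_Ici, hIk]
      simp only
      omega
    · intro i hi j hj
      obtain ⟨a, ha, rfl⟩ := Finset.mem_map.1 hi
      obtain ⟨b, rfl⟩ := (Tuple.sort v).surjective j
      have hb : b < ⟨N - k, hpos⟩ := by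
        by_contra! h
        exact hj (Finset.mem_map.2 ⟨b, Finset.mem_Ici.2 h, rfl⟩)
      exact hmono (hb.le.trans (Finset.mem_Ici.1 ha))
  constructor
  · intro h
    refine ⟨_, ?_, h⟩
    rw [hIJ]
    exact Finset.mem_map.2 ⟨_, Finset.mem_Ici.2 le_rfl, rfl⟩
  · rintro ⟨i, hi, hix⟩
    rw [hIJ] at hi
    obtain ⟨a, ha, rfl⟩ := Finset.mem_map.1 hi
    exact (hmono (Finset.mem_Ici.1 ha)).trans hix

/-! ### Splitting the samples -/

lemma measurePreserving_split {Ω α β γ : Type*} [MeasurableSpace Ω] (P : Measure Ω)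
    [IsProbabilityMeasure P] [Fintype α] [Fintype β] [Fintype γ] (φ : α ⊕ β ≃ γ) :
    MeasurePreserving (fun ω : γ → Ω => (fun i => ω (φ (.inl i)), fun j => ω (φ (.inr j))))
      (Measure.pi fun _ => P) ((Measure.pi fun _ => P).prod (Measure.pi fun _ => P)) := by
  have h1 := (measurePreserving_piCongrLeft (α := fun _ : γ => Ω) (fun _ => P) φ).symm
  have h2 := measurePreserving_sumPiEquivProdPi (X := fun _ : α ⊕ β => Ω) (fun _ => P)
  exact h2.comp h1

/-! ### The shortfall probability through the subset of largest samples -/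

section Shortfall

variable {Ω : Type*} [MeasurableSpace Ω] (P : Measure Ω) [IsProbabilityMeasure P]
  {E : Type*} [MeasurableSpace E] (q : E → Ω → ℝ)

/-- The probability that a new uncertainty has a value at least the least of the values of the
samples `τ`, for the decision `X τ`. -/
def exceedProb {α : Type*} (X : (α → Ω) → E) (τ : α → Ω) : ℝ :=
  P.real {δ | ∃ i, q (X τ) (τ i) ≤ q (X τ) δ}

variable {P q}

lemma measurableSet_exceed {α : Type*} [Fintype α] (hq : Measurable (Function.uncurry q))
    {X : (α → Ω) → E} (hX : Measurable X) :
    MeasurableSet {p : (α → Ω) × Ω | ∃ i, q (X p.1) (p.1 i) ≤ q (X p.1) p.2} := by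
  have : {p : (α → Ω) × Ω | ∃ i, q (X p.1) (p.1 i) ≤ q (X p.1) p.2} =
      ⋃ i, {p : (α → Ω) × Ω | q (X p.1) (p.1 i) ≤ q (X p.1) p.2} := by ext; simp
  rw [this]
  refine MeasurableSet.iUnion fun i => measurableSet_le ?_ ?_
  · exact hq.comp ((hX.comp measurable_fst).prodMk ((measurable_pi_apply i).comp measurable_fst))
  · exact hq.comp ((hX.comp measurable_fst).prodMk measurable_snd)

lemma measurable_exceedProb {α : Type*} [Fintype α] (hq : Measurable (Function.uncurry q))
    {X : (α → Ω) → E} (hX : Measurable X) : Measurable (exceedProb P q X) :=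
  (measurable_measure_prodMk_left (measurableSet_exceed hq hX)).ennreal_toReal

lemma measure_forall_lt {α : Type*} [Fintype α] (hq : Measurable (Function.uncurry q))
    {X : (α → Ω) → E} (hX : Measurable X) (τ : α → Ω) :
    P {δ | ∀ i, q (X τ) δ < q (X τ) (τ i)} = ENNReal.ofReal (1 - exceedProb P q X τ) := by
  have h1 : {δ | ∀ i, q (X τ) δ < q (X τ) (τ i)} = {δ | ∃ i, q (X τ) (τ i) ≤ q (X τ) δ}ᶜ := by
    ext; simp
  have h2 : MeasurableSet {δ | ∃ i, q (X τ) (τ i) ≤ q (X τ) δ} :=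
    measurable_prodMk_left (measurableSet_exceed hq hX)
  rw [h1, exceedProb, ← probReal_compl_eq_one_sub h2, ofReal_measureReal]

/-- The samples for which the first group lies strictly above the second one. -/
def separated {α β : Type*} (q : E → Ω → ℝ) (X : (α → Ω) → E) : Set ((α → Ω) × (β → Ω)) :=
  {p | ∀ j i, q (X p.1) (p.2 j) < q (X p.1) (p.1 i)}

lemma measurableSet_separated {α β : Type*} [Fintype α] [Fintype β]
    (hq : Measurable (Function.uncurry q)) {X : (α → Ω) → E} (hX : Measurable X) :
    MeasurableSet (separated (β := β) q X) := by
  have : separated (β := β) q X =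
      ⋂ j, ⋂ i, {p | q (X p.1) (p.2 j) < q (X p.1) (p.1 i)} := by ext; simp [separated]
  rw [this]
  refine MeasurableSet.iInter fun j => MeasurableSet.iInter fun i => measurableSet_lt ?_ ?_
  · exact hq.comp ((hX.comp measurable_fst).prodMk ((measurable_pi_apply j).comp measurable_snd))
  · exact hq.comp ((hX.comp measurable_fst).prodMk ((measurable_pi_apply i).comp measurable_fst))

/-- Fubini: for a fixed first group the decision is fixed, and the samples of the second group fall
below it independently. -/
lemma measure_separated {α β : Type*} [Fintype α] [Fintype β]
    (hq : Measurable (Function.uncurry q)) {X : (α → Ω) → E} (hX : Measurable X)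
    {A : Set (α → Ω)} (hA : MeasurableSet A) :
    ((Measure.pi fun _ => P).prod (Measure.pi fun _ => P))
        ((Prod.fst ⁻¹' A) ∩ separated (β := β) q X) =
      ∫⁻ τ in A, ENNReal.ofReal (1 - exceedProb P q X τ) ^ Fintype.card β
        ∂(Measure.pi fun _ => P) := by
  rw [Measure.prod_apply ((measurable_fst hA).inter (measurableSet_separated hq hX)),
    ← lintegral_indicator hA]
  refine lintegral_congr fun τ => ?_
  by_cases hτ : τ ∈ A
  · have : Prod.mk τ ⁻¹' (Prod.fst ⁻¹' A ∩ separated (β := β) q X) =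
        Set.univ.pi fun _ => {δ | ∀ i, q (X τ) δ < q (X τ) (τ i)} := by
      ext ρ; simp [separated, hτ]
    rw [this, Measure.pi_pi, Set.indicator_of_mem hτ]
    simp [measure_forall_lt hq hX]
  · have : Prod.mk τ ⁻¹' (Prod.fst ⁻¹' A ∩ separated (β := β) q X) = ∅ := by
      ext ρ; simp [hτ]
    rw [this, Set.indicator_of_notMem hτ, measure_empty]

/-- The decision depends on the first group only, so given that group a tie is an event that a fresh
sample hits one prescribed value. -/
lemma ae_ne {α β : Type*} [Fintype α] [Fintype β]
    (hq : Measurable (Function.uncurry q)) (hP : ∀ x c, P {δ | q x δ = c} = 0)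
    {X : (α → Ω) → E} (hX : Measurable X) :
    ∀ᵐ p ∂((Measure.pi fun _ : α => P).prod (Measure.pi fun _ : β => P)),
      ∀ j i, q (X p.1) (p.2 j) ≠ q (X p.1) (p.1 i) := by
  refine ae_all_iff.2 fun j => ae_all_iff.2 fun i => ?_
  have hms : MeasurableSet {p : (α → Ω) × (β → Ω) | q (X p.1) (p.2 j) = q (X p.1) (p.1 i)} := by
    refine measurableSet_eq_fun ?_ ?_
    · exact hq.comp ((hX.comp measurable_fst).prodMk ((measurable_pi_apply j).comp measurable_snd))
    · exact hq.comp ((hX.comp measurable_fst).prodMk ((measurable_pi_apply i).comp measurable_fst))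
  have h0 := (Measure.measure_prod_null (μ := Measure.pi fun _ : α => P)
    (ν := Measure.pi fun _ : β => P) hms).2 (Filter.Eventually.of_forall fun τ => by
      have hm : MeasurableSet {δ | q (X τ) δ = q (X τ) (τ i)} :=
        measurableSet_eq_fun (hq.comp measurable_prodMk_left) measurable_const
      have := (measurePreserving_eval (fun _ : β => P) j).measure_preimage hm.nullMeasurableSet
      rw [hP] at this
      exact this)
  rw [ae_iff]
  simpa using h0

/-- For atomless values, the shortfall probability of an optimal decision is determined by the law
of `exceedProb` for the optimal decision of `m + dim E` samples. -/
theorem measure_probShortfall_le {E : Type*} [NormedAddCommGroup E] [NormedSpace ℝ E]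
    [FiniteDimensional ℝ E] [MeasurableSpace E] [BorelSpace E] {q : E → Ω → ℝ}
    (hconv : ∀ δ, ConvexOn ℝ Set.univ fun x => q x δ)
    (hq : Measurable (Function.uncurry q)) (hP : ∀ x c, P {δ | q x δ = c} = 0)
    {m k r N : ℕ} (hm : 0 < m) (hk : k = m + Module.finrank ℝ E) (hN : N = k + r)
    {X : (Fin k → Ω) → E} (hXm : Measurable X)
    (hX : ∀ τ x, topSum m (fun i => q (X τ) (τ i)) ≤ topSum m (fun i => q x (τ i)))
    (hX' : ∀ τ x, (∀ y, topSum m (fun i => q x (τ i)) ≤ topSum m (fun i => q y (τ i))) → x = X τ)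
    {Y : (Fin N → Ω) → E}
    (hY : ∀ ω x, topSum m (fun i => q (Y ω) (ω i)) ≤ topSum m (fun i => q x (ω i)))
    (hY' : ∀ ω x, (∀ y, topSum m (fun i => q x (ω i)) ≤ topSum m (fun i => q y (ω i))) → x = Y ω)
    (ε : ℝ) :
    (Measure.pi fun _ : Fin N => P)
        {ω | P.real {δ | orderStat (fun j => q (Y ω) (ω j)) k ≤ q (Y ω) δ} ≤ ε} =
      N.choose k * ∫⁻ τ in {τ | exceedProb P q X τ ≤ ε},
        ENNReal.ofReal (1 - exceedProb P q X τ) ^ r ∂(Measure.pi fun _ => P) := by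
  set A : Set (Fin k → Ω) := {τ | exceedProb P q X τ ≤ ε} with hAdef
  have hA : MeasurableSet A := measurable_exceedProb hq hXm measurableSet_Iic
  let T := {I : Finset (Fin N) // I.card = k}
  have hTc : ∀ I : T, (I.1ᶜ).card = r := fun I => by
    rw [Finset.card_compl, Fintype.card_fin, I.2]; omega
  let φ : T → Fin k ⊕ Fin r ≃ Fin N := fun I => finSumEquivOfFinset I.2 (hTc I)
  let split : T → (Fin N → Ω) → (Fin k → Ω) × (Fin r → Ω) := fun I ω =>
    (fun i => ω (φ I (.inl i)), fun j => ω (φ I (.inr j)))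
  have hsplit : ∀ I, MeasurePreserving (split I) (Measure.pi fun _ => P)
      ((Measure.pi fun _ => P).prod (Measure.pi fun _ => P)) :=
    fun I => measurePreserving_split P (φ I)
  have hmemI : ∀ (I : T) l, l ∈ I.1 ↔ ∃ i, φ I (.inl i) = l := by
    intro I l
    simp only [φ, finSumEquivOfFinset_inl]
    rw [← Finset.mem_coe, ← Finset.range_orderEmbOfFin I.1 I.2]
    rfl
  have hnotI : ∀ (I : T) l, l ∉ I.1 ↔ ∃ j, φ I (.inr j) = l := by
    intro I l
    simp only [φ, finSumEquivOfFinset_inr]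
    rw [← Finset.mem_compl, ← Finset.mem_coe, ← Finset.range_orderEmbOfFin I.1ᶜ (hTc I)]
    rfl
  have hinj : ∀ I : T, Function.Injective fun i => φ I (.inl i) :=
    fun I => (φ I).injective.comp Sum.inl_injective
  have hsep : ∀ I ω, split I ω ∈ separated q X ↔
      ∀ i ∈ I.1, ∀ j ∉ I.1, q (X (split I ω).1) (ω j) < q (X (split I ω).1) (ω i) := by
    intro I ω
    constructor
    · intro h i hi j hj
      obtain ⟨i, rfl⟩ := (hmemI I _).1 hi
      obtain ⟨j, rfl⟩ := (hnotI I _).1 hj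
      exact h j i
    · intro h j i
      exact h _ ((hmemI I _).2 ⟨i, rfl⟩) _ ((hnotI I _).2 ⟨j, rfl⟩)
  -- Samples strictly below the group at its optimum do not enter the top sum there, and elsewhere
  -- extra samples can only raise it.
  have hYX : ∀ I ω, split I ω ∈ separated q X → Y ω = X (split I ω).1 := by
    intro I ω h
    rw [hsep] at h
    refine (hY' ω _ fun y => ?_).symm
    have h1 := topSum_comp_eq hm (by simp; omega : m ≤ Fintype.card (Fin k))
      (fun l => q (X (split I ω).1) (ω l)) (hinj I) (fun i j hj => by
        refine (h _ ((hmemI I _).2 ⟨i, rfl⟩) j fun hj' => hj ?_).le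
        exact (hmemI I _).1 hj')
    rw [← h1]
    refine (hX (split I ω).1 y).trans ?_
    exact topSum_comp_le (by simp; omega : m ≤ Fintype.card (Fin k)) (fun l => q y (ω l)) (hinj I)
  have hPS : ∀ I ω, split I ω ∈ separated q X →
      P.real {δ | orderStat (fun j => q (Y ω) (ω j)) k ≤ q (Y ω) δ} =
        exceedProb P q X (split I ω).1 := by
    intro I ω h
    rw [hYX I ω h, exceedProb]
    rw [hsep] at h
    congr 1
    ext δ
    simp only [Set.mem_ofPred_eq]
    rw [orderStat_le_iff (by omega) _ I.2 h]
    constructor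
    · rintro ⟨l, hl, hlδ⟩
      obtain ⟨i, rfl⟩ := (hmemI I _).1 hl
      exact ⟨i, hlδ⟩
    · rintro ⟨i, hi⟩
      exact ⟨_, (hmemI I _).2 ⟨i, rfl⟩, hi⟩
  -- The deterministic half supplies the index set with weak inequalities; the absence of ties makes
  -- them strict.
  have hex : ∀ ω, (∀ I : T, ∀ j i, q (X (split I ω).1) ((split I ω).2 j) ≠
      q (X (split I ω).1) ((split I ω).1 i)) → ∃ I, split I ω ∈ separated q X := by
    intro ω hne
    obtain ⟨I, hIc, hItop, hI⟩ := exists_top_subproblem (ι := Fin N) (q := fun l x => q x (ω l))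
      hm (by simp; omega) (fun l => hconv (ω l)) (hY ω)
    let I' : T := ⟨I, hIc.trans hk.symm⟩
    have hrange : Set.range (fun i => φ I' (.inl i)) = I := by
      ext l
      exact (hmemI I' l).symm
    have hXY : Y ω = X (split I' ω).1 := hX' _ _ fun y => hI _ (hinj I') hrange y
    refine ⟨I', fun j i => lt_of_le_of_ne ?_ (hne I' j i)⟩
    rw [← hXY]
    exact hItop _ ((hmemI I' _).2 ⟨i, rfl⟩) _ ((hnotI I' _).2 ⟨j, rfl⟩)
  have hae : ∀ᵐ ω ∂(Measure.pi fun _ : Fin N => P), ∀ I : T, ∀ j i,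
      q (X (split I ω).1) ((split I ω).2 j) ≠ q (X (split I ω).1) ((split I ω).1 i) :=
    ae_all_iff.2 fun I => (hsplit I).quasiMeasurePreserving.ae (ae_ne hq hP hXm)
  -- `Y` is not assumed measurable; the event is handled through an almost everywhere equal
  -- measurable union.
  have hset : {ω | P.real {δ | orderStat (fun j => q (Y ω) (ω j)) k ≤ q (Y ω) δ} ≤ ε} =ᵐ[
      Measure.pi fun _ : Fin N => P] ⋃ I, split I ⁻¹' (Prod.fst ⁻¹' A ∩ separated q X) := by
    filter_upwards [hae] with ω hω
    refine propext ?_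
    change _ ≤ ε ↔ ω ∈ ⋃ I, _
    simp only [Set.mem_iUnion, Set.mem_preimage, Set.mem_inter_iff, hAdef, Set.mem_ofPred_eq]
    constructor
    · intro h
      obtain ⟨I, hI⟩ := hex ω hω
      exact ⟨I, by rwa [← hPS I ω hI], hI⟩
    · rintro ⟨I, h, hI⟩
      rwa [hPS I ω hI]
  have hms : MeasurableSet (Prod.fst ⁻¹' A ∩ separated (β := Fin r) q X) :=
    (measurable_fst hA).inter (measurableSet_separated hq hXm)
  rw [measure_congr hset, measure_iUnion ?_ fun I => (hsplit I).measurable hms]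
  · simp_rw [(hsplit _).measure_preimage hms.nullMeasurableSet, measure_separated hq hXm hA]
    rw [tsum_fintype, Finset.sum_const, Finset.card_univ, Fintype.card_finset_len,
      Fintype.card_fin, Fintype.card_fin, nsmul_eq_mul]
  -- Both index sets would hold the `k` largest values at the same point `Y ω`.
  · intro I J hne
    refine Set.disjoint_left.2 fun ω hI hJ => hne (Subtype.ext ?_)
    have h1 := (hsep I ω).1 hI.2
    have h2 := (hsep J ω).1 hJ.2
    rw [← hYX I ω hI.2] at h1
    rw [← hYX J ω hJ.2] at h2
    exact top_unique (fun l => q (Y ω) (ω l)) (I.2.trans J.2.symm) h1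
      fun i hi j hj => (h2 i hi j hj).le

end Shortfall

/-! ### Measures on the unit interval and their moments -/

/-- A finite measure on `[0, 1]` is determined by its moments. -/
lemma measure_ext_of_moments {μ ν : Measure ℝ} [IsFiniteMeasure μ] [IsFiniteMeasure ν]
    (hμ : ∀ᵐ x ∂μ, x ∈ Set.Icc (0 : ℝ) 1) (hν : ∀ᵐ x ∂ν, x ∈ Set.Icc (0 : ℝ) 1)
    (h : ∀ r : ℕ, ∫⁻ x, ENNReal.ofReal x ^ r ∂μ = ∫⁻ x, ENNReal.ofReal x ^ r ∂ν) : μ = ν := by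
  have hmom : ∀ (ρ : Measure ℝ), (∀ᵐ x ∂ρ, x ∈ Set.Icc (0 : ℝ) 1) → ∀ r : ℕ,
      ∫ x, x ^ r ∂ρ = (∫⁻ x, ENNReal.ofReal x ^ r ∂ρ).toReal := by
    intro ρ hρ r
    rw [integral_eq_lintegral_of_nonneg_ae]
    · congr 1
      refine lintegral_congr_ae ?_
      filter_upwards [hρ] with x hx
      rw [ENNReal.ofReal_pow hx.1]
    · filter_upwards [hρ] with x hx
      exact pow_nonneg hx.1 r
    · exact (by fun_prop : Continuous fun x : ℝ => x ^ r).aestronglyMeasurable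
  have hint : ∀ (ρ : Measure ℝ) [IsFiniteMeasure ρ], (∀ᵐ x ∂ρ, x ∈ Set.Icc (0 : ℝ) 1) →
      ∀ f : ℝ → ℝ, Continuous f → Integrable f ρ := by
    intro ρ _ hρ f hf
    obtain ⟨C, hC⟩ := isCompact_Icc.exists_bound_of_continuousOn (hf.continuousOn (s := Set.Icc 0 1))
    refine Integrable.of_bound hf.aestronglyMeasurable C ?_
    filter_upwards [hρ] with x hx using hC x hx
  have hpoly : ∀ p : Polynomial ℝ, ∫ x, p.eval x ∂μ = ∫ x, p.eval x ∂ν := by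
    intro p
    simp only [Polynomial.eval_eq_sum_range]
    rw [integral_finsetSum _ fun i _ => hint μ hμ _ (by fun_prop),
      integral_finsetSum _ fun i _ => hint ν hν _ (by fun_prop)]
    refine Finset.sum_congr rfl fun i _ => ?_
    rw [integral_const_mul, integral_const_mul, hmom μ hμ, hmom ν hν, h]
  refine ext_of_forall_integral_eq_of_IsFiniteMeasure fun f => ?_
  -- Weierstrass approximation passes from polynomials to continuous test functions.
  have happ : ∀ (ρ : Measure ℝ) [IsFiniteMeasure ρ], (∀ᵐ x ∂ρ, x ∈ Set.Icc (0 : ℝ) 1) →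
      ∀ (p : Polynomial ℝ) (ε : ℝ), (∀ x ∈ Set.Icc (0 : ℝ) 1, |p.eval x - f x| < ε) →
      |∫ x, p.eval x ∂ρ - ∫ x, f x ∂ρ| ≤ ε * ρ.real Set.univ := by
    intro ρ _ hρ p ε hp
    rw [← integral_sub (hint ρ hρ _ p.continuous) (hint ρ hρ _ f.continuous)]
    rw [← Real.norm_eq_abs]
    refine norm_integral_le_of_norm_le_const (μ := ρ) ?_
    filter_upwards [hρ] with x hx using (hp x hx).le
  have hle : ∀ ε > 0, |∫ x, f x ∂μ - ∫ x, f x ∂ν| ≤ ε * (μ.real Set.univ + ν.real Set.univ) := by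
    intro ε hε
    obtain ⟨p, hp⟩ := exists_polynomial_near_of_continuousOn 0 1 f f.continuous.continuousOn ε hε
    have h1 := abs_le.1 (happ μ hμ p ε hp)
    have h2 := abs_le.1 (happ ν hν p ε hp)
    rw [hpoly p] at h1
    rw [abs_le]
    constructor <;> linarith
  have hlim : Filter.Tendsto (fun ε : ℝ => ε * (μ.real Set.univ + ν.real Set.univ))
      (nhdsWithin 0 (Set.Ioi 0)) (nhds 0) := by
    have : Continuous fun ε : ℝ => ε * (μ.real Set.univ + ν.real Set.univ) := by fun_prop
    simpa using (this.tendsto 0).mono_left nhdsWithin_le_nhds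
  have := ge_of_tendsto hlim (b := |∫ x, f x ∂μ - ∫ x, f x ∂ν|)
    (by filter_upwards [self_mem_nhdsWithin] with ε hε using hle ε hε)
  exact sub_eq_zero.1 (abs_nonpos_iff.1 this)

open ProbabilityTheory in
lemma measurable_betaPDF (a b : ℝ) : Measurable (betaPDF a b) :=
  (measurable_betaPDFReal a b).ennreal_ofReal

open ProbabilityTheory in
lemma betaPDF_one_natCast {k : ℕ} (hk : 0 < k) {x : ℝ} (hx : x ∈ Set.Ioo (0 : ℝ) 1) :
    betaPDF 1 k x = ENNReal.ofReal (k * (1 - x) ^ (k - 1)) := by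
  have hk' : (0 : ℝ) < k := by exact_mod_cast hk
  rw [betaPDF_of_pos_lt_one hx.1 hx.2, beta, add_comm, Real.Gamma_add_one hk'.ne', Real.Gamma_one,
    sub_self, Real.rpow_zero]
  have : ((k : ℝ) - 1) = ((k - 1 : ℕ) : ℝ) := by rw [Nat.cast_sub hk, Nat.cast_one]
  rw [this, Real.rpow_natCast]
  have := (Real.Gamma_pos_of_pos hk').ne'
  congr 1
  field_simp

-- Multiplying the Beta(1, k) density by `x ^ r` gives `k * beta (r + 1) k` times the Beta(r + 1, k)
-- density, which has mass 1.
open ProbabilityTheory in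
lemma lintegral_pow_betaMeasure {k : ℕ} (hk : 0 < k) (r : ℕ) :
    ∫⁻ x, ENNReal.ofReal x ^ r ∂(betaMeasure 1 k) = ((k + r).choose k : ENNReal)⁻¹ := by
  have hk' : (0 : ℝ) < k := by exact_mod_cast hk
  have hr : (0 : ℝ) < (r : ℝ) + 1 := by positivity
  have hpdf : Measurable (betaPDF 1 k) := measurable_betaPDF 1 k
  rw [betaMeasure, lintegral_withDensity_eq_lintegral_mul _ hpdf (by fun_prop)]
  obtain ⟨C, hC⟩ : ∃ C : ℝ, C = k * beta (r + 1) k := ⟨_, rfl⟩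
  have hpt : ∀ x, (betaPDF 1 k * fun x => ENNReal.ofReal x ^ r) x =
      ENNReal.ofReal C * betaPDF (r + 1) k x := by
    intro x
    rw [Pi.mul_apply]
    by_cases hx : x ∈ Set.Ioo (0 : ℝ) 1
    · rw [betaPDF_one_natCast hk hx, betaPDF_of_pos_lt_one hx.1 hx.2, hC, ← ENNReal.ofReal_pow hx.1.le,
        ← ENNReal.ofReal_mul (mul_nonneg hk'.le (pow_nonneg (by linarith [hx.2]) _)),
        ← ENNReal.ofReal_mul (mul_nonneg hk'.le (beta_pos hr hk').le)]
      have : ((k : ℝ) - 1) = ((k - 1 : ℕ) : ℝ) := by rw [Nat.cast_sub hk, Nat.cast_one]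
      rw [this, Real.rpow_natCast, add_sub_cancel_right, Real.rpow_natCast]
      have := (beta_pos hr hk').ne'
      congr 1
      field_simp
    · rw [betaPDF_eq, betaPDF_eq, if_neg (by simpa using hx), if_neg (by simpa using hx)]
      simp
  simp_rw [hpt]
  rw [lintegral_const_mul _ (measurable_betaPDF _ _),
    lintegral_betaPDF_eq_one hr hk', mul_one]
  have hCval : C = ((k + r).choose k : ℝ)⁻¹ := by
    obtain ⟨l, rfl⟩ : ∃ l, k = l + 1 := ⟨k - 1, by omega⟩
    have e1 : ((r : ℝ) + 1 + ((l + 1 : ℕ) : ℝ)) = ((l + 1 + r : ℕ) : ℝ) + 1 := by push_cast; ring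
    rw [hC, beta, e1, Real.Gamma_nat_eq_factorial, Real.Gamma_nat_eq_factorial, Nat.cast_succ l,
      Real.Gamma_nat_eq_factorial, Nat.cast_choose ℝ (Nat.le_add_right _ _),
      Nat.add_sub_cancel_left, Nat.factorial_succ l]
    have h1 : (((l + 1 + r).factorial : ℕ) : ℝ) ≠ 0 := by positivity
    push_cast
    field_simp
  rw [hCval, ENNReal.ofReal_inv_of_pos (by exact_mod_cast Nat.choose_pos (Nat.le_add_right _ _)),
    ENNReal.ofReal_natCast]

open ProbabilityTheory in
lemma ae_betaMeasure_mem_Ioo (a b : ℝ) : ∀ᵐ x ∂(betaMeasure a b), x ∈ Set.Ioo (0 : ℝ) 1 := by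
  rw [betaMeasure, ae_withDensity_iff (measurable_betaPDF a b)]
  refine Filter.Eventually.of_forall fun x hx => ?_
  by_contra h
  exact hx (by rw [betaPDF_eq, if_neg (by simpa using h), ENNReal.ofReal_zero])

-- This is the substitution `p = 1 - x`, since Beta(1, k) will be the law of `1 - V`.
open ProbabilityTheory in
lemma setLIntegral_pow_betaMeasure {k : ℕ} (hk : 0 < k) (r : ℕ) {ε : ℝ}
    (hε : ε ∈ Set.Ioo (0 : ℝ) 1) :
    ∫⁻ x in Set.Ici (1 - ε), ENNReal.ofReal x ^ r ∂(betaMeasure 1 k) =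
      ENNReal.ofReal (∫ p in (0 : ℝ)..ε, k * p ^ (k - 1) * (1 - p) ^ r) := by
  have hpdf : Measurable (betaPDF 1 k) := measurable_betaPDF 1 k
  have hsub : ∫ p in (0 : ℝ)..ε, (k : ℝ) * p ^ (k - 1) * (1 - p) ^ r =
      ∫ x in (1 - ε)..1, (k : ℝ) * (1 - x) ^ (k - 1) * x ^ r := by
    have := intervalIntegral.integral_comp_sub_left (a := 0) (b := ε)
      (fun x : ℝ => (k : ℝ) * (1 - x) ^ (k - 1) * x ^ r) 1
    simpa using this
  rw [hsub, intervalIntegral.integral_of_le (by linarith [hε.1]), integral_Ioc_eq_integral_Ioo,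
    ofReal_integral_eq_lintegral_ofReal]
  · rw [betaMeasure, restrict_withDensity measurableSet_Ici,
      lintegral_withDensity_eq_lintegral_mul _ hpdf (by fun_prop), ← lintegral_indicator
      measurableSet_Ici, ← lintegral_indicator measurableSet_Ioo]
    have hne : ∀ᵐ x : ℝ, x ≠ 1 - ε := by simp [ae_iff, measure_singleton]
    refine lintegral_congr_ae ?_
    filter_upwards [hne] with x hx1
    by_cases hx : x ∈ Set.Ioo (1 - ε) 1
    · have hx' : x ∈ Set.Ioo (0 : ℝ) 1 := ⟨by linarith [hx.1, hε.2], hx.2⟩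
      rw [Set.indicator_of_mem hx, Set.indicator_of_mem (show x ∈ Set.Ici (1 - ε) from hx.1.le),
        Pi.mul_apply, betaPDF_one_natCast hk hx', ← ENNReal.ofReal_pow hx'.1.le,
        ← ENNReal.ofReal_mul (mul_nonneg k.cast_nonneg (pow_nonneg (by linarith [hx.2]) _))]
    · rw [Set.indicator_of_notMem hx]
      by_cases hx2 : x ∈ Set.Ici (1 - ε)
      · have : 1 ≤ x := by
          by_contra! h
          exact hx ⟨lt_of_le_of_ne hx2 hx1.symm, h⟩
        rw [Set.indicator_of_mem hx2, Pi.mul_apply, betaPDF_eq_zero_of_one_le this, zero_mul]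
      · rw [Set.indicator_of_notMem hx2]
  · refine ((by fun_prop : Continuous fun x : ℝ => (k : ℝ) * (1 - x) ^ (k - 1) * x ^ r)
      |>.integrableOn_Icc (a := 1 - ε) (b := 1)).mono_set Set.Ioo_subset_Icc_self
  · refine ae_restrict_of_forall_mem measurableSet_Ioo fun x hx => ?_
    exact mul_nonneg (mul_nonneg k.cast_nonneg (pow_nonneg (by linarith [hx.2]) _))
      (pow_nonneg (by linarith [hx.1, hε.2]) _)

/-! ### The law of the shortfall probability -/

open ProbabilityTheory in
/-- The shortfall probability of the optimal decision has a Beta distribution. -/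
theorem measureReal_probShortfall_le {Ω : Type*} [MeasurableSpace Ω] {P : Measure Ω}
    [IsProbabilityMeasure P] {E : Type*} [NormedAddCommGroup E] [NormedSpace ℝ E]
    [FiniteDimensional ℝ E] {q : E → Ω → ℝ} (hconv : ∀ δ, ConvexOn ℝ Set.univ fun x => q x δ)
    (hq : ∀ x, Measurable (q x)) (hP : ∀ x c, P {δ | q x δ = c} = 0)
    {m k N : ℕ} (hm : 0 < m) (hk : k = m + Module.finrank ℝ E) (hkN : k ≤ N)
    (hX : ∀ l, k ≤ l → ∀ ω : Fin l → Ω, ∃! x, ∀ y,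
      topSum m (fun i => q x (ω i)) ≤ topSum m (fun i => q y (ω i)))
    {Y : (Fin N → Ω) → E}
    (hY : ∀ ω x, topSum m (fun i => q (Y ω) (ω i)) ≤ topSum m (fun i => q x (ω i)))
    {ε : ℝ} (hε : ε ∈ Set.Ioo (0 : ℝ) 1) :
    (Measure.pi fun _ : Fin N => P).real
        {ω | P.real {δ | orderStat (fun j => q (Y ω) (ω j)) k ≤ q (Y ω) δ} ≤ ε} =
      ∫ p in (0 : ℝ)..ε, N.choose k * k * p ^ (k - 1) * (1 - p) ^ (N - k) := by
  have hk0 : 0 < k := by omega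
  borelize E
  have : ProperSpace E := FiniteDimensional.proper_real E
  have hcont : ∀ δ, Continuous fun x => q x δ := fun δ =>
    continuousOn_univ.1 ((hconv δ).continuousOn isOpen_univ)
  have hqU : Measurable (Function.uncurry q) :=
    measurable_uncurry_of_continuous_of_measurable hcont hq
  choose Z hZ hZ' using hX
  simp only at hZ hZ'
  have hmk : m ≤ Fintype.card (Fin k) := by simp; omega
  have hZm : Measurable (Z k le_rfl) := by
    refine measurable_argmin (f := fun x (τ : Fin k → Ω) => topSum m (fun i => q x (τ i)))
      (fun τ => (continuous_topSum hmk).comp (continuous_pi fun i => hcont _))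
      (fun x => (continuous_topSum hmk).measurable.comp
        (measurable_pi_lambda _ fun i => (hq x).comp (measurable_pi_apply i)))
      (hZ k le_rfl) fun τ x hx => hZ' k le_rfl τ x hx
  set X := Z k le_rfl with hXdef
  have hmain := fun (r : ℕ) (Y : (Fin (k + r) → Ω) → E) hY hY' (ε : ℝ) =>
    measure_probShortfall_le (P := P) (Y := Y) hconv hqU hP hm hk (rfl : k + r = k + r) hZm
      (hZ k le_rfl) (hZ' k le_rfl) hY hY' ε
  have hV0 : ∀ τ, 0 ≤ exceedProb P q X τ := fun τ => measureReal_nonneg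
  have hV1 : ∀ τ, exceedProb P q X τ ≤ 1 := fun τ => measureReal_le_one
  have hVm : Measurable fun τ => 1 - exceedProb P q X τ :=
    measurable_const.sub (measurable_exceedProb hqU hZm)
  have hmoment : ∀ r : ℕ, ∫⁻ τ, ENNReal.ofReal (1 - exceedProb P q X τ) ^ r
      ∂(Measure.pi fun _ => P) = ((k + r).choose k : ENNReal)⁻¹ := by
    intro r
    -- At level 1 every event is certain, which leaves the moment equation. Unique optima are needed
    -- here for all sample sizes `k + r`.
    have h1 := hmain r (Z (k + r) (Nat.le_add_right _ _)) (hZ _ _) (hZ' _ _) 1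
    have h2 : ∀ s : Set Ω, P.real s ≤ 1 := fun s => measureReal_le_one
    simp only [h2, hV1, Set.ofPred_true, Measure.restrict_univ, measure_univ] at h1
    exact ENNReal.eq_inv_of_mul_eq_one_left (by rw [mul_comm]; exact h1.symm)
  have hlaw : (Measure.pi fun _ => P).map (fun τ => 1 - exceedProb P q X τ) =
      betaMeasure 1 k := by
    have := isProbabilityMeasureBeta one_pos (by exact_mod_cast hk0 : (0 : ℝ) < k)
    have := Measure.isProbabilityMeasure_map (μ := Measure.pi fun _ : Fin k => P) hVm.aemeasurable
    refine measure_ext_of_moments ?_ ?_ fun r => ?_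
    · refine (ae_map_iff hVm.aemeasurable measurableSet_Icc).2 ?_
      exact Filter.Eventually.of_forall fun τ => ⟨by linarith [hV1 τ], by linarith [hV0 τ]⟩
    · filter_upwards [ae_betaMeasure_mem_Ioo 1 k] with x hx using ⟨hx.1.le, hx.2.le⟩
    · rw [lintegral_pow_betaMeasure hk0, lintegral_map (by fun_prop) hVm, hmoment]
  obtain ⟨r, rfl⟩ : ∃ r, N = k + r := ⟨N - k, by omega⟩
  have h1 := hmain r Y hY
    (fun ω x hx => (hZ' _ hkN ω x hx).trans (hZ' _ hkN ω _ (hY ω)).symm) ε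
  have h2 : ∫⁻ τ in {τ | exceedProb P q X τ ≤ ε}, ENNReal.ofReal (1 - exceedProb P q X τ) ^ r
      ∂(Measure.pi fun _ => P) = ∫⁻ x in Set.Ici (1 - ε), ENNReal.ofReal x ^ r
        ∂(betaMeasure 1 k) := by
    rw [← hlaw, setLIntegral_map measurableSet_Ici (by fun_prop) hVm]
    congr 2
    ext τ
    simp only [Set.mem_ofPred_eq, Set.mem_preimage, Set.mem_Ici, sub_le_sub_iff_left]
  rw [h2, setLIntegral_pow_betaMeasure hk0 r hε] at h1
  rw [Measure.real, h1, ENNReal.toReal_mul, ENNReal.toReal_natCast, ENNReal.toReal_ofReal,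
    ← intervalIntegral.integral_const_mul, Nat.add_sub_cancel_left]
  · simp only [mul_assoc]
  · refine intervalIntegral.integral_nonneg hε.1.le fun p hp => ?_
    exact mul_nonneg (mul_nonneg k.cast_nonneg (pow_nonneg hp.1 _))
      (pow_nonneg (by linarith [hp.2, hε.2]) _)

/-! ### The sum of the largest singular values is convex -/

section KyFan

variable {V : Type*} [NormedAddCommGroup V] [InnerProductSpace ℝ V]

/-- A finite family satisfying Bessel's inequality. -/
def IsBessel {ι : Type*} [Fintype ι] (w : ι → V) : Prop :=
  ∀ x, ∑ j, inner ℝ (w j) x ^ 2 ≤ ‖x‖ ^ 2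

lemma IsBessel.norm_sq_le_one {ι : Type*} [Fintype ι] {w : ι → V} (hw : IsBessel w) (j : ι) :
    ‖w j‖ ^ 2 ≤ 1 := by
  have h1 := (Finset.single_le_sum (f := fun l => inner ℝ (w l) (w j) ^ 2)
    (fun l _ => sq_nonneg _) (Finset.mem_univ j)).trans (hw (w j))
  rw [real_inner_self_eq_norm_sq] at h1
  nlinarith [sq_nonneg ‖w j‖]

/-- Expand `‖x - ∑ ⟨w j, x⟩ w j‖² ≥ 0`; vectors of norm below 1, even zero, are allowed. -/
lemma isBessel_of_pairwise {ι : Type*} [Fintype ι] {w : ι → V}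
    (horth : ∀ i j, i ≠ j → inner ℝ (w i) (w j) = 0) (hnorm : ∀ i, ‖w i‖ ^ 2 ≤ 1) :
    IsBessel w := by
  intro x
  have h1 : inner ℝ x (∑ j, inner ℝ (w j) x • w j) = ∑ j, inner ℝ (w j) x ^ 2 := by
    rw [inner_sum]
    refine Finset.sum_congr rfl fun j _ => ?_
    rw [real_inner_smul_right, real_inner_comm, sq]
  have h2 : ‖∑ j, inner ℝ (w j) x • w j‖ ^ 2 = ∑ j, inner ℝ (w j) x ^ 2 * ‖w j‖ ^ 2 := by
    rw [← real_inner_self_eq_norm_sq, sum_inner]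
    refine Finset.sum_congr rfl fun i _ => ?_
    rw [inner_sum, Finset.sum_eq_single i (fun j _ hj => by
      rw [real_inner_smul_left, real_inner_smul_right, horth i j hj.symm]; ring) (by simp)]
    rw [real_inner_smul_left, real_inner_smul_right, real_inner_self_eq_norm_sq]
    ring
  have h3 : ∑ j, inner ℝ (w j) x ^ 2 * ‖w j‖ ^ 2 ≤ ∑ j, inner ℝ (w j) x ^ 2 :=
    Finset.sum_le_sum fun j _ => mul_le_of_le_one_right (sq_nonneg _) (hnorm j)
  have h4 := norm_sub_sq_real x (∑ j, inner ℝ (w j) x • w j)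
  rw [h1, h2] at h4
  nlinarith [sq_nonneg ‖x - ∑ j, inner ℝ (w j) x • w j‖]

variable [FiniteDimensional ℝ V]

/-- Singular value decomposition with a Bessel family on the left. -/
lemma exists_singularValue_decomposition {n : ℕ} (hn : Module.finrank ℝ V = n) (T : V →ₗ[ℝ] V) :
    ∃ (b : OrthonormalBasis (Fin n) ℝ V) (w : Fin n → V), IsBessel w ∧
      (∀ i, T (b i) = T.singularValues i • w i) ∧
      ∀ i, inner ℝ (w i) (T (b i)) = T.singularValues i := by
  have hT := T.isSymmetric_adjoint_comp_self
  set b := hT.eigenvectorBasis hn with hb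
  have hinner : ∀ i j, inner ℝ (T (b i)) (T (b j)) =
      if i = j then T.singularValues i ^ 2 else 0 := by
    intro i j
    rw [← LinearMap.adjoint_inner_right, ← LinearMap.comp_apply, hb, hT.apply_eigenvectorBasis hn j,
      real_inner_smul_right, orthonormal_iff_ite.1 (hT.eigenvectorBasis hn).orthonormal,
      T.sq_singularValues_fin hn]
    split_ifs with h
    · simp [h]
    · simp
  have hz : ∀ i, T.singularValues (i : Fin n) = 0 → T (b i) = 0 := by
    intro i hi
    have := hinner i i
    rw [if_pos rfl, hi, real_inner_self_eq_norm_sq] at this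
    simpa using this
  -- For a zero singular value the inverse is 0 and so is the vector, whence a Bessel family rather
  -- than an orthonormal one.
  refine ⟨b, fun i => (T.singularValues i)⁻¹ • T (b i), isBessel_of_pairwise ?_ ?_, ?_, ?_⟩
  · intro i j hij
    rw [real_inner_smul_left, real_inner_smul_right, hinner, if_neg hij]
    ring
  · intro i
    rw [← real_inner_self_eq_norm_sq, real_inner_smul_left, real_inner_smul_right, hinner,
      if_pos rfl]
    rcases eq_or_ne (T.singularValues i) 0 with h | h
    · simp [h]
    · field_simp
      exact le_rfl
  · intro i
    rcases eq_or_ne (T.singularValues i) 0 with h | h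
    · rw [hz i h, h]; simp
    · rw [smul_smul, mul_inv_cancel₀ h, one_smul]
  · intro i
    rw [real_inner_smul_left, hinner, if_pos rfl]
    rcases eq_or_ne (T.singularValues i) 0 with h | h
    · simp [h]
    · field_simp

lemma sum_range_eq_sum_filter {n k : ℕ} (hk : k ≤ n) (f : ℕ → ℝ) :
    ∑ i ∈ Finset.range k, f i = ∑ i : Fin n with i.1 < k, f i := by
  rw [Finset.sum_filter, Fin.sum_univ_eq_sum_range (fun i => if i < k then f i else 0),
    ← Finset.sum_filter]
  refine Finset.sum_congr ?_ fun _ _ => rfl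
  ext i
  simp only [Finset.mem_range, Finset.mem_filter]
  omega

lemma card_filter_val_lt {n k : ℕ} (hk : k ≤ n) :
    (Finset.univ.filter fun i : Fin n => i.1 < k).card = k := by
  have := sum_range_eq_sum_filter hk fun _ => 1
  simp only [Finset.sum_const, Finset.card_range, nsmul_eq_mul, mul_one] at this
  exact_mod_cast this.symm

/-- Expanding in the singular bases and using `2xy ≤ x² + y²` bounds the left side by a weighted sum
of singular values. By Bessel the weights are at most 1 and have total at most `k`. -/
lemma sum_inner_le_sum_singularValues {k : ℕ} (hk : k ≤ Module.finrank ℝ V) (T : V →ₗ[ℝ] V)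
    {ι : Type*} [Fintype ι] (hι : Fintype.card ι = k) {u w : ι → V} (hu : IsBessel u)
    (hw : IsBessel w) :
    ∑ j, inner ℝ (w j) (T (u j)) ≤ ∑ i ∈ Finset.range k, T.singularValues i := by
  obtain ⟨n, hn⟩ : ∃ n, Module.finrank ℝ V = n := ⟨_, rfl⟩
  rw [hn] at hk
  obtain ⟨b, w', hw', hTb, -⟩ := exists_singularValue_decomposition hn T
  set a : Fin n → ℝ := fun i => ∑ j, (inner ℝ (u j) (b i) ^ 2 + inner ℝ (w j) (w' i) ^ 2) / 2
    with ha
  have hterm : ∀ j, inner ℝ (w j) (T (u j)) ≤ ∑ i, T.singularValues (i : Fin n) *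
      ((inner ℝ (u j) (b i) ^ 2 + inner ℝ (w j) (w' i) ^ 2) / 2) := by
    intro j
    have h1 : T (u j) = ∑ i, (inner ℝ (b i) (u j) * T.singularValues i) • w' i := by
      conv_lhs => rw [← b.sum_repr' (u j)]
      simp only [map_sum, map_smul, hTb, smul_smul]
    rw [h1, inner_sum]
    refine Finset.sum_le_sum fun i _ => ?_
    rw [real_inner_smul_right, real_inner_comm]
    have := T.singularValues_nonneg i
    nlinarith [sq_nonneg (inner ℝ (u j) (b i) - inner ℝ (w j) (w' i)),
      mul_nonneg this (sq_nonneg (inner ℝ (u j) (b i) - inner ℝ (w j) (w' i)))]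
  have ha0 : ∀ i, 0 ≤ a i := fun i => Finset.sum_nonneg fun j _ => by positivity
  have ha1 : ∀ i, a i ≤ 1 := by
    intro i
    have h1 := hu (b i)
    have h2 := (hw (w' i)).trans (hw'.norm_sq_le_one i)
    rw [b.orthonormal.1 i] at h1
    rw [ha]
    simp only [← Finset.sum_div, Finset.sum_add_distrib]
    linarith
  have hasum : ∑ i, a i ≤ k := by
    rw [ha]
    simp only
    rw [Finset.sum_comm]
    have : ∀ j, ∑ i, (inner ℝ (u j) (b i) ^ 2 + inner ℝ (w j) (w' i) ^ 2) / 2 ≤ 1 := by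
      intro j
      have h1 : ∑ i, inner ℝ (u j) (b i) ^ 2 ≤ 1 := by
        rw [b.sum_sq_inner_left]
        exact hu.norm_sq_le_one j
      have h2 : ∑ i, inner ℝ (w j) (w' i) ^ 2 ≤ 1 := by
        simp_rw [real_inner_comm (w' _) (w j)]
        exact (hw' (w j)).trans (hw.norm_sq_le_one j)
      rw [← Finset.sum_div, Finset.sum_add_distrib]
      linarith
    refine (Finset.sum_le_sum fun j _ => this j).trans ?_
    simp [hι]
  calc ∑ j, inner ℝ (w j) (T (u j)) ≤ ∑ j, ∑ i, T.singularValues (i : Fin n) *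
        ((inner ℝ (u j) (b i) ^ 2 + inner ℝ (w j) (w' i) ^ 2) / 2) :=
        Finset.sum_le_sum fun j _ => hterm j
    _ = ∑ i : Fin n, a i * T.singularValues i := by
        rw [Finset.sum_comm]
        refine Finset.sum_congr rfl fun i _ => ?_
        rw [← Finset.mul_sum, mul_comm]
    _ ≤ ∑ i : Fin n with i.1 < k, T.singularValues i := by
        -- Indices start at 0, so `T.singularValues k` bounds all omitted values. Its nonnegativity
        -- compensates for a total weight below `k`.
        refine sum_mul_le_sum_of_threshold a _ _ (T.singularValues k) ha0 ha1 ?_ ?_ ?_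
        · rw [card_filter_val_lt hk]
          exact mul_nonpos_of_nonneg_of_nonpos (T.singularValues_nonneg k) (by linarith)
        · intro i hi
          exact T.singularValues_antitone (Finset.mem_filter.1 hi).2.le
        · intro i hi
          exact T.singularValues_antitone (by simpa using hi)
    _ = _ := (sum_range_eq_sum_filter hk fun i => T.singularValues i).symm

lemma exists_sum_inner_eq_sum_singularValues {k : ℕ} (hk : k ≤ Module.finrank ℝ V)
    (T : V →ₗ[ℝ] V) :
    ∃ u w : Fin k → V, IsBessel u ∧ IsBessel w ∧
      ∑ i ∈ Finset.range k, T.singularValues i = ∑ j, inner ℝ (w j) (T (u j)) := by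
  obtain ⟨n, hn⟩ : ∃ n, Module.finrank ℝ V = n := ⟨_, rfl⟩
  rw [hn] at hk
  obtain ⟨b, w', hw', hTb, hin⟩ := exists_singularValue_decomposition hn T
  refine ⟨fun j => b (Fin.castLE hk j), fun j => w' (Fin.castLE hk j), ?_, ?_, ?_⟩
  · refine isBessel_of_pairwise (fun i j hij => ?_) fun i => ?_
    · exact b.orthonormal.2 fun h => hij (Fin.castLE_injective hk h)
    · simp
  · intro x
    refine le_trans ?_ (hw' x)
    have := Finset.sum_le_sum_of_subset_of_nonneg
      (f := fun i => inner ℝ (w' i) x ^ 2)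
      (Finset.subset_univ (Finset.univ.map (Fin.castLEEmb hk))) fun i _ _ => sq_nonneg _
    simpa using this
  · simp only [hin, Fin.val_castLE]
    exact (Fin.sum_univ_eq_sum_range (fun i => T.singularValues i) k).symm

/-- Ky Fan: the sum of the `k` largest singular values is a convex function of the map. -/
lemma convexOn_sum_singularValues {k : ℕ} (hk : k ≤ Module.finrank ℝ V) :
    ConvexOn ℝ Set.univ fun T : V →ₗ[ℝ] V => ∑ i ∈ Finset.range k, T.singularValues i := by
  refine ⟨convex_univ, fun S _ T _ a b ha hb _ => ?_⟩
  obtain ⟨u, w, hu, hw, h⟩ := exists_sum_inner_eq_sum_singularValues hk (a • S + b • T)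
  simp only [smul_eq_mul]
  rw [h]
  simp only [LinearMap.add_apply, LinearMap.smul_apply, inner_add_right, real_inner_smul_right,
    Finset.sum_add_distrib, ← Finset.mul_sum]
  gcongr
  · exact sum_inner_le_sum_singularValues hk S (Fintype.card_fin k) hu hw
  · exact sum_inner_le_sum_singularValues hk T (Fintype.card_fin k) hu hw

end KyFan

/-! ### The inverse of `κ` is affine in the controller -/

/-- The lower shift on `h` blocks. -/
def shift (h : ℕ) : Matrix (Fin h) (Fin h) ℝ :=
  Matrix.of fun i j => if j.val + 1 = i.val then 1 else 0

lemma shift_kronecker_mul_apply {n h : ℕ} (M : Matrix (Fin n) (Fin n) ℝ)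
    (S : Matrix (Fin h × Fin n) (Fin h × Fin n) ℝ) (i : Fin h) (a : Fin n) (p : Fin h × Fin n) :
    ((shift h ⊗ₖ M) * S) (i, a) p =
      if hi : 0 < i.val then ∑ c, M a c * S (⟨i.val - 1, by omega⟩, c) p else 0 := by
  rw [Matrix.mul_apply, Fintype.sum_prod_type]
  simp only [Matrix.kronecker_apply, shift, Matrix.of_apply]
  split_ifs with hi
  · rw [Finset.sum_eq_single (⟨i.val - 1, by omega⟩ : Fin h)]
    · refine Finset.sum_congr rfl fun c _ => ?_
      rw [if_pos (by simp only; omega), one_mul]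
    · intro l _ hl
      refine Finset.sum_eq_zero fun c _ => ?_
      rw [if_neg (fun h' => hl (Fin.ext (by simp only; omega)))]
      ring
    · simp
  · refine Finset.sum_eq_zero fun l _ => Finset.sum_eq_zero fun c _ => ?_
    rw [if_neg (by omega)]
    ring

/-- A finite geometric series: `stacked h M B` is `∑ (shift h) ^ l ⊗ M ^ l` times `1 ⊗ B`, and the
shift is nilpotent. -/
lemma sub_shift_kronecker_mul_stacked {n h : ℕ} (M B : Matrix (Fin n) (Fin n) ℝ) :
    (1 - shift h ⊗ₖ M) * stacked h M B = (1 : Matrix (Fin h) (Fin h) ℝ) ⊗ₖ B := by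
  rw [sub_mul, one_mul]
  ext ⟨i, a⟩ ⟨j, b⟩
  rw [Matrix.sub_apply, shift_kronecker_mul_apply]
  simp only [stacked, Matrix.of_apply, Matrix.kronecker_apply, Matrix.one_apply, Fin.le_def,
    Fin.ext_iff]
  rcases lt_trichotomy j.val i.val with hij | hij | hij
  · have hpow : M ^ (i.val - j.val) * B = M * (M ^ (i.val - 1 - j.val) * B) := by
      rw [← mul_assoc, ← pow_succ']
      congr 2
      omega
    rw [if_pos hij.le, dif_pos (by omega), if_neg (by omega), zero_mul, hpow, Matrix.mul_apply]
    simp only [if_pos (show j.val ≤ i.val - 1 by omega), sub_self]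
  · rw [if_pos hij.le, if_pos hij.symm, hij, Nat.sub_self, pow_zero, one_mul, one_mul]
    split_ifs <;> first | omega | simp
  · rw [if_neg (by omega), if_neg (by omega)]
    split_ifs <;> first | omega | simp

lemma sub_shift_kronecker_mul_stackedStrict {n h : ℕ} (M D : Matrix (Fin n) (Fin n) ℝ) :
    (1 - shift h ⊗ₖ M) * stackedStrict h M D = shift h ⊗ₖ D := by
  rw [sub_mul, one_mul]
  ext ⟨i, a⟩ ⟨j, b⟩
  rw [Matrix.sub_apply, shift_kronecker_mul_apply]
  simp only [stackedStrict, shift, Matrix.of_apply, Matrix.kronecker_apply, Fin.lt_def]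
  rcases lt_trichotomy (j.val + 1) i.val with hij | hij | hij
  · have hpow : M ^ (i.val - j.val - 1) * D = M * (M ^ (i.val - 1 - j.val - 1) * D) := by
      rw [← mul_assoc, ← pow_succ']
      congr 2
      omega
    rw [if_pos (by omega), dif_pos (by omega), if_neg (by omega), zero_mul, hpow, Matrix.mul_apply]
    simp only [if_pos (show j.val < i.val - 1 by omega), sub_self]
  · rw [if_pos (by omega), if_pos hij, dif_pos (by omega)]
    simp [show ¬ j.val < i.val - 1 by omega, show i.val - j.val - 1 = 0 by omega]
  · rw [if_neg (by omega), if_neg (by omega)]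
    split_ifs <;> first | omega | simp

lemma isUnit_sub_shift_kronecker {n : ℕ} (h : ℕ) (M : Matrix (Fin n) (Fin n) ℝ) :
    IsUnit (1 - shift h ⊗ₖ M) := by
  have := sub_shift_kronecker_mul_stacked (h := h) M 1
  rw [Matrix.one_kronecker_one] at this
  exact IsUnit.of_mul_eq_one _ this

lemma isUnit_one_kronecker {n : ℕ} (h : ℕ) {B : Matrix (Fin n) (Fin n) ℝ} (hB : IsUnit B) :
    IsUnit ((1 : Matrix (Fin h) (Fin h) ℝ) ⊗ₖ B) := by
  obtain ⟨b, rfl⟩ := hB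
  refine IsUnit.of_mul_eq_one ((1 : Matrix (Fin h) (Fin h) ℝ) ⊗ₖ (↑b⁻¹ : Matrix _ _ ℝ)) ?_
  rw [← Matrix.mul_kronecker_mul, one_mul, Units.mul_inv, Matrix.one_kronecker_one]

namespace UncertainSystem

variable {Ω : Type*} {n : ℕ}

/-- The controller enters nonlinearly only through `Fxa`, which cancels between `F_r` and `F_p⁻¹`.
What remains is affine in `K`. -/
lemma kappa_inv (s : UncertainSystem Ω n) (h : ℕ) (hB : IsUnit s.B) (hC : IsUnit s.C)
    (K : Matrix (Fin n) (Fin n) ℝ) (δ : Ω) :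
    (s.kappa h K δ)⁻¹ = ((1 : Matrix (Fin h) (Fin h) ℝ) ⊗ₖ s.C) *
      (1 - shift h ⊗ₖ (s.Aδ δ - s.L * s.C))⁻¹ * (1 - shift h ⊗ₖ (s.A + s.B * K * s.C)) *
        ((1 : Matrix (Fin h) (Fin h) ℝ) ⊗ₖ s.CJ)⁻¹ := by
  set U := 1 - shift h ⊗ₖ (s.Aδ δ - s.L * s.C) with hU
  set W := 1 - shift h ⊗ₖ (s.Aδ δ + s.B * K * s.C) with hW
  set Y := 1 - shift h ⊗ₖ (s.A + s.B * K * s.C) with hY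
  have hUu : IsUnit U := isUnit_sub_shift_kronecker h _
  have hYu : IsUnit Y := isUnit_sub_shift_kronecker h _
  have h1 : W * s.Fxa h K δ = (1 : Matrix (Fin h) (Fin h) ℝ) ⊗ₖ s.B :=
    sub_shift_kronecker_mul_stacked _ _
  have h2 : U * s.Fea h δ = (1 : Matrix (Fin h) (Fin h) ℝ) ⊗ₖ s.B :=
    sub_shift_kronecker_mul_stacked _ _
  have h3 : U * s.Fex h δ = shift h ⊗ₖ s.ΔA δ := sub_shift_kronecker_mul_stackedStrict _ _
  have hF : IsUnit (s.Fxa h K δ) :=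
    isUnit_of_mul_isUnit_right (h1 ▸ isUnit_one_kronecker h hB)
  -- The feedback of the uncertainty through `Fex` removes `ΔA δ` from the closed-loop factor.
  have hWY : W + shift h ⊗ₖ s.ΔA δ = Y := by
    rw [hW, hY, Aδ, add_right_comm, Matrix.kronecker_add _ (s.A + _)]
    abel
  have h4 : U * (s.Fea h δ + s.Fex h δ * s.Fxa h K δ) = Y * s.Fxa h K δ := by
    rw [mul_add, ← mul_assoc, h2, h3, ← h1, ← add_mul, hWY]
  have h5 : s.Fea h δ + s.Fex h δ * s.Fxa h K δ = U⁻¹ * Y * s.Fxa h K δ := by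
    rw [mul_assoc, ← h4, ← mul_assoc,
      Matrix.nonsing_inv_mul _ ((Matrix.isUnit_iff_isUnit_det _).1 hUu), one_mul]
  have hFr : s.Fr h K δ = (1 : Matrix (Fin h) (Fin h) ℝ) ⊗ₖ s.C * (U⁻¹ * Y * s.Fxa h K δ) := by
    rw [Fr, h5]
  have hFru : IsUnit (s.Fr h K δ) := by
    rw [hFr]
    exact (isUnit_one_kronecker h hC).mul
      (((Matrix.isUnit_nonsing_inv_iff.2 hUu).mul hYu).mul hF)
  rw [kappa, Matrix.mul_inv_rev,
    Matrix.nonsing_inv_nonsing_inv _ ((Matrix.isUnit_iff_isUnit_det _).1 hFru), Fp,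
    Matrix.mul_inv_rev, hFr]
  calc _ = ((1 : Matrix (Fin h) (Fin h) ℝ) ⊗ₖ s.C) * U⁻¹ * Y *
        (s.Fxa h K δ * (s.Fxa h K δ)⁻¹) * ((1 : Matrix (Fin h) (Fin h) ℝ) ⊗ₖ s.CJ)⁻¹ := by
        simp only [mul_assoc]
    _ = _ := by
        rw [Matrix.mul_nonsing_inv _ ((Matrix.isUnit_iff_isUnit_det _).1 hF), mul_one]

lemma kappa_inv_combination (s : UncertainSystem Ω n) (h : ℕ) (hB : IsUnit s.B) (hC : IsUnit s.C)
    (δ : Ω) (K K' : Matrix (Fin n) (Fin n) ℝ) {a b : ℝ} (hab : a + b = 1) :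
    (s.kappa h (a • K + b • K') δ)⁻¹ = a • (s.kappa h K δ)⁻¹ + b • (s.kappa h K' δ)⁻¹ := by
  simp only [kappa_inv s h hB hC]
  have h1 : s.A + s.B * (a • K + b • K') * s.C =
      a • (s.A + s.B * K * s.C) + b • (s.A + s.B * K' * s.C) := by
    have : s.A = a • s.A + b • s.A := by rw [← add_smul, hab, one_smul]
    conv_lhs => rw [this]
    simp only [mul_add, add_mul, mul_smul_comm, smul_mul_assoc, smul_add]
    abel
  have h2 : (1 : Matrix (Fin h × Fin n) (Fin h × Fin n) ℝ) = a • 1 + b • 1 := by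
    rw [← add_smul, hab, one_smul]
  have h3 : (1 : Matrix (Fin h × Fin n) (Fin h × Fin n) ℝ) -
      shift h ⊗ₖ (s.A + s.B * (a • K + b • K') * s.C) =
      a • (1 - shift h ⊗ₖ (s.A + s.B * K * s.C)) +
        b • (1 - shift h ⊗ₖ (s.A + s.B * K' * s.C)) := by
    rw [h1, Matrix.kronecker_add, Matrix.kronecker_smul, Matrix.kronecker_smul, smul_sub, smul_sub]
    conv_lhs => rw [h2]
    abel
  rw [h3]
  simp only [mul_add, add_mul, mul_smul_comm, smul_mul_assoc]

/-- The part of the impact proxy without regularization. -/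
def rawImpact (s : UncertainSystem Ω n) (h : ℕ) (K : Matrix (Fin n) (Fin n) ℝ) (δ : Ω) : ℝ :=
  ∑ i ∈ Finset.range (n * h - 1), (Matrix.toEuclideanLin (s.kappa h K δ)⁻¹).singularValues i

lemma rawImpact_nonneg (s : UncertainSystem Ω n) (h : ℕ) (K : Matrix (Fin n) (Fin n) ℝ) (δ : Ω) :
    0 ≤ s.rawImpact h K δ :=
  Finset.sum_nonneg fun _ _ => LinearMap.singularValues_nonneg _ _

lemma convexOn_rawImpact (s : UncertainSystem Ω n) (h : ℕ) (hB : IsUnit s.B) (hC : IsUnit s.C)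
    (δ : Ω) : ConvexOn ℝ Set.univ fun K => s.rawImpact h K δ := by
  refine ⟨convex_univ, fun K _ K' _ a b ha hb hab => ?_⟩
  have hk : n * h - 1 ≤ Module.finrank ℝ (EuclideanSpace ℝ (Fin h × Fin n)) := by
    rw [finrank_euclideanSpace, Fintype.card_prod, Fintype.card_fin, Fintype.card_fin, mul_comm h]
    omega
  have := (convexOn_sum_singularValues hk).2
    (Set.mem_univ (Matrix.toEuclideanLin (s.kappa h K δ)⁻¹))
    (Set.mem_univ (Matrix.toEuclideanLin (s.kappa h K' δ)⁻¹)) ha hb hab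
  simp only [rawImpact, kappa_inv_combination s h hB hC δ K K' hab, map_add, map_smul]
  exact this

end UncertainSystem

/-! ### Regularized programs have a unique optimum -/

/-- Adding a positive multiple of a squared Euclidean norm to a nonnegative convex function makes
the minimiser exist and be unique. -/
lemma existsUnique_minimizer_of_regularized {E : Type*} [NormedAddCommGroup E] [NormedSpace ℝ E]
    [FiniteDimensional ℝ E] {F s : E → ℝ} (hF : ConvexOn ℝ Set.univ F) (hF0 : ∀ x, 0 ≤ F x)
    (hs : Continuous s) (hs_norm : ∀ x, ‖x‖ ^ 2 ≤ s x)
    (hs_mid : ∀ x y, s ((1 / 2 : ℝ) • x + (1 / 2 : ℝ) • y) = (s x + s y) / 2 - s (x - y) / 4)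
    {c : ℝ} (hc : 0 < c) : ∃! x, ∀ y, F x + c * s x ≤ F y + c * s y := by
  have : ProperSpace E := FiniteDimensional.proper_real E
  have hcont : Continuous fun x => F x + c * s x :=
    (continuousOn_univ.1 (hF.continuousOn isOpen_univ)).add (hs.const_mul c)
  have hlim : Filter.Tendsto (fun x => F x + c * s x) (Filter.cocompact E) Filter.atTop := by
    have h1 : Filter.Tendsto (fun x : E => c * ‖x‖ ^ 2) (Filter.cocompact E) Filter.atTop :=
      ((Filter.tendsto_pow_atTop two_ne_zero).comp
        (tendsto_norm_cocompact_atTop (E := E))).const_mul_atTop hc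
    refine Filter.tendsto_atTop_mono (fun x => ?_) h1
    have := mul_le_mul_of_nonneg_left (hs_norm x) hc.le
    linarith [hF0 x]
  obtain ⟨x, hx⟩ := hcont.exists_forall_le hlim
  refine ⟨x, hx, fun y hy => ?_⟩
  have h1 := hF.2 (Set.mem_univ x) (Set.mem_univ y) (by norm_num : (0 : ℝ) ≤ 1 / 2)
    (by norm_num : (0 : ℝ) ≤ 1 / 2) (by norm_num)
  have h2 := hx ((1 / 2 : ℝ) • x + (1 / 2 : ℝ) • y)
  have h3 := hy ((1 / 2 : ℝ) • x + (1 / 2 : ℝ) • y)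
  -- By the parallelogram identity two minimisers would be beaten at their midpoint unless `s (x -
  -- y) ≤ 0`.
  rw [hs_mid] at h2 h3
  simp only [smul_eq_mul] at h1
  have h4 : c * s (x - y) ≤ 0 := by linarith
  have h5 : ‖x - y‖ ^ 2 ≤ 0 := (hs_norm _).trans (nonpos_of_mul_nonpos_right h4 hc)
  have h6 : ‖x - y‖ = 0 := pow_eq_zero_iff two_ne_zero |>.1 (le_antisymm h5 (sq_nonneg _))
  exact (sub_eq_zero.1 (norm_eq_zero.1 h6)).symm

/-! ### The scenario program -/

section Program

variable {Ω : Type*} {n N m : ℕ} {q : Matrix (Fin n) (Fin n) ℝ → Ω → ℝ}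

lemma isFeasible_iff (hm : 0 < m) (hmN : m ≤ N) (ω : Fin N → Ω) (K : Matrix (Fin n) (Fin n) ℝ)
    (y : ℝ) : IsFeasible m q ω K y ↔ topSum m (fun j => q K (ω j)) ≤ m * y := by
  have hm' : (0 : ℝ) < m := by exact_mod_cast hm
  have hdiv : ∀ a : ℝ, 1 / (m : ℝ) * a ≤ y ↔ a ≤ m * y := fun a => by
    rw [one_div, inv_mul_le_iff₀ hm']
  simp only [IsFeasible, hdiv]
  constructor
  · intro h
    obtain ⟨S, hS, hST⟩ := exists_topSum_eq (by simpa using hmN) fun j => q K (ω j)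
    rw [hST]
    exact h S hS
  · intro h S hS
    exact (sum_le_topSum _ hS).trans h

/-- The variable `y` is eliminated: its least feasible value for `K` is the top sum divided by `m`.
-/
lemma isOptimalController_iff (hm : 0 < m) (hmN : m ≤ N) (ω : Fin N → Ω)
    (K : Matrix (Fin n) (Fin n) ℝ) :
    IsOptimalController m q ω K ↔
      ∀ K', topSum m (fun j => q K (ω j)) ≤ topSum m (fun j => q K' (ω j)) := by
  have hm' : (0 : ℝ) < m := by exact_mod_cast hm
  simp only [IsOptimalController, isFeasible_iff hm hmN]
  constructor
  · rintro ⟨y, hy, hmin⟩ K'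
    have := hmin K' (topSum m (fun j => q K' (ω j)) / m) (by rw [mul_div_cancel₀ _ hm'.ne'])
    rw [le_div_iff₀ hm'] at this
    linarith
  · intro h
    refine ⟨topSum m (fun j => q K (ω j)) / m, by rw [mul_div_cancel₀ _ hm'.ne'],
      fun K' y' hy' => ?_⟩
    rw [div_le_iff₀ hm']
    linarith [h K']

/-- The law of the shortfall probability for a convex impact proxy with unique optima. -/
theorem measureReal_probShortfall_le_eq_integral [MeasurableSpace Ω] {P : Measure Ω}
    [IsProbabilityMeasure P] {d : ℕ} (hm : 0 < m) (hd : d = n ^ 2) (hNmd : m + d ≤ N)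
    {ε : ℝ} (hε : ε ∈ Set.Ioo (0 : ℝ) 1)
    (hconv : ∀ δ, ConvexOn ℝ Set.univ fun K => q K δ) (hq : ∀ K, Measurable (q K))
    (hP : NoPointMasses P q)
    (huniq : ∀ k : ℕ, m + d ≤ k → ∀ ω : Fin k → Ω, ∃! K, IsOptimalController m q ω K)
    {Kstar : (Fin N → Ω) → Matrix (Fin n) (Fin n) ℝ}
    (hK : ∀ ω, IsOptimalController m q ω (Kstar ω)) :
    (Measure.pi fun _ : Fin N => P).real {ω | probShortfall P (m + d) q ω (Kstar ω) ≤ ε} =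
      ∫ p in (0 : ℝ)..ε,
        Real.Gamma ((N : ℝ) + 1) /
            (Real.Gamma ((m : ℝ) + d) * Real.Gamma ((N : ℝ) + 1 - m - d)) *
          p ^ (m + d - 1) * (1 - p) ^ (N - m - d) := by
  let _ : NormedAddCommGroup (Matrix (Fin n) (Fin n) ℝ) := Matrix.normedAddCommGroup
  let _ : NormedSpace ℝ (Matrix (Fin n) (Fin n) ℝ) := Matrix.normedSpace
  have hrank : m + d = m + Module.finrank ℝ (Matrix (Fin n) (Fin n) ℝ) := by
    rw [Module.finrank_matrix, Fintype.card_fin, Module.finrank_self, hd]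
    ring
  have h := measureReal_probShortfall_le (P := P) (E := Matrix (Fin n) (Fin n) ℝ) (q := q)
    (Y := Kstar) hconv hq hP hm hrank hNmd
    (fun l hl ω => by
      simpa only [isOptimalController_iff hm (by omega : m ≤ l)] using huniq l hl ω)
    (fun ω => (isOptimalController_iff hm (by omega) ω _).1 (hK ω)) hε
  -- With k = m + d both sides are N! / ((k - 1)! (N - k)!).
  have hconst : ((N.choose (m + d) : ℝ) * (m + d : ℕ)) =
      Real.Gamma ((N : ℝ) + 1) /
        (Real.Gamma ((m : ℝ) + d) * Real.Gamma ((N : ℝ) + 1 - m - d)) := by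
    obtain ⟨l, hl⟩ : ∃ l, m + d = l + 1 := ⟨m + d - 1, by omega⟩
    have e1 : (m : ℝ) + d = (l : ℝ) + 1 := by exact_mod_cast hl
    have e2 : (N : ℝ) + 1 - m - d = ((N - (m + d) : ℕ) : ℝ) + 1 := by
      rw [Nat.cast_sub hNmd]; push_cast; ring
    rw [e2, e1, Real.Gamma_nat_eq_factorial, Real.Gamma_nat_eq_factorial,
      Real.Gamma_nat_eq_factorial, Nat.cast_choose ℝ hNmd, hl, Nat.factorial_succ]
    push_cast
    field_simp
  simp only [hconst] at h
  simp only [Nat.sub_sub]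
  exact h

end Program

/-! ### Convexity and unique optima for the regularized impact proxy -/

namespace UncertainSystem

variable {Ω : Type*} {n : ℕ}

lemma convexOn_sum_sq : ConvexOn ℝ Set.univ
    fun K : Matrix (Fin n) (Fin n) ℝ => ∑ i, ∑ j, K i j ^ 2 := by
  refine ⟨convex_univ, fun K _ K' _ a b ha hb hab => ?_⟩
  simp only [smul_eq_mul, Finset.mul_sum, ← Finset.sum_add_distrib]
  refine Finset.sum_le_sum fun i _ => Finset.sum_le_sum fun j _ => ?_
  exact (even_two.convexOn_pow (𝕜 := ℝ)).2 (Set.mem_univ (K i j)) (Set.mem_univ (K' i j)) ha hb hab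

lemma convexOn_impactProxy (s : UncertainSystem Ω n) (h : ℕ) {η : ℝ} (hη : 0 ≤ η)
    (hB : IsUnit s.B) (hC : IsUnit s.C) (δ : Ω) :
    ConvexOn ℝ Set.univ fun K => s.impactProxy h η K δ :=
  (convexOn_sum_sq.smul hη).add (s.convexOn_rawImpact h hB hC δ)

lemma existsUnique_isOptimalController (s : UncertainSystem Ω n) (h : ℕ) {η : ℝ} (hη : 0 < η)
    (hB : IsUnit s.B) (hC : IsUnit s.C) {m N : ℕ} (hm : 0 < m) (hmN : m ≤ N) (ω : Fin N → Ω) :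
    ∃! K, IsOptimalController m (s.impactProxy h η) ω K := by
  have hmN' : m ≤ Fintype.card (Fin N) := by simpa using hmN
  have hm' : (0 : ℝ) < m := by exact_mod_cast hm
  -- The regularization is the same for all samples, so it leaves the top sum with a factor `m`.
  have hrw : ∀ K, topSum m (fun j => s.impactProxy h η K (ω j)) =
      topSum m (fun j => s.rawImpact h K (ω j)) + m * η * ∑ i, ∑ j, K i j ^ 2 := by
    intro K
    rw [mul_assoc, ← topSum_add_const hmN']
    congr 1
    ext j
    rw [impactProxy, rawImpact, add_comm]
  simp only [isOptimalController_iff hm hmN, hrw]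
  let _ : NormedAddCommGroup (Matrix (Fin n) (Fin n) ℝ) := Matrix.normedAddCommGroup
  let _ : NormedSpace ℝ (Matrix (Fin n) (Fin n) ℝ) := Matrix.normedSpace
  refine existsUnique_minimizer_of_regularized (E := Matrix (Fin n) (Fin n) ℝ)
    (F := fun K => topSum m (fun j => s.rawImpact h K (ω j)))
    (s := fun K => ∑ i, ∑ j, K i j ^ 2) ?_ ?_ ?_ ?_ ?_ (mul_pos hm' hη)
  · refine ⟨convex_univ, fun K _ K' _ a b ha hb hab => ?_⟩
    refine (topSum_mono hmN' fun j => (s.convexOn_rawImpact h hB hC (ω j)).2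
      (Set.mem_univ K) (Set.mem_univ K') ha hb hab).trans ?_
    exact (convexOn_topSum hmN').2 (Set.mem_univ fun j => s.rawImpact h K (ω j))
      (Set.mem_univ fun j => s.rawImpact h K' (ω j)) ha hb hab
  · intro K
    obtain ⟨S, -, hST⟩ := exists_topSum_eq hmN' fun j => s.rawImpact h K (ω j)
    rw [hST]
    exact Finset.sum_nonneg fun j _ => s.rawImpact_nonneg h K _
  · exact continuousOn_univ.1 (ConvexOn.continuousOn isOpen_univ convexOn_sum_sq)
  · intro K
    have h0 : 0 ≤ ∑ i, ∑ j, K i j ^ 2 :=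
      Finset.sum_nonneg fun i _ => Finset.sum_nonneg fun j _ => sq_nonneg _
    -- The norm in force is the entrywise maximum, which the Frobenius norm dominates.
    have h1 : ‖K‖ ≤ √(∑ i, ∑ j, K i j ^ 2) := by
      rw [Matrix.norm_le_iff (Real.sqrt_nonneg _)]
      intro i j
      refine Real.abs_le_sqrt ?_
      refine (Finset.single_le_sum (f := fun j => K i j ^ 2) (fun j _ => sq_nonneg _)
        (Finset.mem_univ j)).trans ?_
      exact Finset.single_le_sum (f := fun i => ∑ j, K i j ^ 2)
        (fun i _ => Finset.sum_nonneg fun j _ => sq_nonneg _) (Finset.mem_univ i)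
    calc ‖K‖ ^ 2 ≤ √(∑ i, ∑ j, K i j ^ 2) ^ 2 := by gcongr
      _ = _ := Real.sq_sqrt h0
  · intro K K'
    simp only [← Finset.sum_add_distrib, Finset.sum_div, ← Finset.sum_sub_distrib]
    refine Finset.sum_congr rfl fun i _ => Finset.sum_congr rfl fun j _ => ?_
    simp only [Matrix.add_apply, Matrix.smul_apply, Matrix.sub_apply, smul_eq_mul]
    ring

end UncertainSystem

end ShortfallControl

end

theorem mainTheorem1 {Ω : Type*} [MeasurableSpace Ω] (P : Measure Ω) [IsProbabilityMeasure P]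
    (n N m d : ℕ) (hN : 0 < N) (α : ℝ) (hα : α ∈ Set.Ioo (0 : ℝ) 1)
    (hm : m = ⌈(N : ℝ) * (1 - α)⌉₊) (hd : d = n ^ 2) (hNmd : m + d ≤ N)
    (ε : ℝ) (hε : ε ∈ Set.Ioo (0 : ℝ) 1) :
    -- any convex impact proxy for which optimal controllers are well defined
    (∀ q : Matrix (Fin n) (Fin n) ℝ → Ω → ℝ,
      (∀ δ, ConvexOn ℝ Set.univ fun K => q K δ) →
      (∀ K, Measurable (q K)) →
      ShortfallControl.NoPointMasses P q →
      (∀ k : ℕ, m + d ≤ k → ∀ ω : Fin k → Ω,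
        ∃! K, ShortfallControl.IsOptimalController m q ω K) →
      ∀ Kstar : (Fin N → Ω) → Matrix (Fin n) (Fin n) ℝ,
        (∀ ω, ShortfallControl.IsOptimalController m q ω (Kstar ω)) →
        (Measure.pi fun _ : Fin N => P).real
            {ω | ShortfallControl.probShortfall P (m + d) q ω (Kstar ω) ≤ ε} =
          ∫ p in (0 : ℝ)..ε,
            Real.Gamma ((N : ℝ) + 1) /
                (Real.Gamma ((m : ℝ) + d) * Real.Gamma ((N : ℝ) + 1 - m - d)) *
              p ^ (m + d - 1) * (1 - p) ^ (N - m - d)) ∧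
    -- the regularized impact proxy of the uncertain control system
    (∀ (s : ShortfallControl.UncertainSystem Ω n) (Nh : ℕ) (η : ℝ), 0 < η →
      IsUnit s.B → IsUnit s.C → IsUnit s.CJ →
      (∀ K, Measurable (s.impactProxy Nh η K)) →
      ShortfallControl.NoPointMasses P (s.impactProxy Nh η) →
      (∀ ω : Fin N → Ω,
        ∃! K, ShortfallControl.IsOptimalController m (s.impactProxy Nh η) ω K) ∧
      ∀ Kstar : (Fin N → Ω) → Matrix (Fin n) (Fin n) ℝ,
        (∀ ω, ShortfallControl.IsOptimalController m (s.impactProxy Nh η) ω (Kstar ω)) →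
        (Measure.pi fun _ : Fin N => P).real
            {ω | ShortfallControl.probShortfall P (m + d) (s.impactProxy Nh η) ω (Kstar ω) ≤ ε} =
          ∫ p in (0 : ℝ)..ε,
            Real.Gamma ((N : ℝ) + 1) /
                (Real.Gamma ((m : ℝ) + d) * Real.Gamma ((N : ℝ) + 1 - m - d)) *
              p ^ (m + d - 1) * (1 - p) ^ (N - m - d)) := by
  have hm0 : 0 < m := by
    have hN' : (0 : ℝ) < N := by exact_mod_cast hN
    rw [hm, Nat.ceil_pos]
    exact mul_pos hN' (by linarith [hα.2])
  refine ⟨fun q hconv hq hP huniq Kstar hK =>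
    ShortfallControl.measureReal_probShortfall_le_eq_integral hm0 hd hNmd hε hconv hq hP huniq hK,
    fun s Nh η hη hB hC _ hq hP => ⟨fun ω =>
      s.existsUnique_isOptimalController Nh hη hB hC hm0 (by omega) ω, fun Kstar hK => ?_⟩⟩
  -- Optima of the regularized program are unique for every sample size at least `m`, so the general
  -- convex case applies.
  exact ShortfallControl.measureReal_probShortfall_le_eq_integral hm0 hd hNmd hε
    (s.convexOn_impactProxy Nh hη.le hB hC) hq hP
    (fun k hk ω => s.existsUnique_isOptimalController Nh hη hB hC hm0 (by omega) ω) hK
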